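/- Let $w_0\in C^\infty(\mathbb{R}^2)$ be a radial function with $w_0(x)=\ln|x|$ for $|x|\ge 1$. Let $K:\mathbb{R}^2\to\mathbb{R}$ be a measurable, locally bounded function with $K\le 0$, let $\alpha>0$ and $t\in\mathbb{R}$. Equations are understood in the sense of distributions. Assume that there exists a bounded solution $v$ of $$-\Delta v = K e^{2\alpha w_0+2t}+\alpha\Delta w_0\quad\text{in }\mathbb{R}^2 .$$ Then the equation $$\Delta u+K(x)e^{2u}=0\quad\text{in }\mathbb{R}^2$$ has exactly one continuous solution $u$ satisfying $u(x)=\alpha\ln|x|+O(1)$ as $|x|\to\infty$. Moreover, for this solution $Ke^{2u}\in L^1(\mathbb{R}^2)$, and its total curvature is $$\int_{\mathbb{R}^2}K e^{2u}\,dx=-2\alpha\pi .$$ -/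

import Mathlib

open MeasureTheory Asymptotics Filter
open scoped ContDiff

/-- The Euclidean plane, with its Euclidean norm and Lebesgue measure. -/
abbrev Plane : Type := EuclideanSpace ℝ (Fin 2)

/-- `-Δ u = f` in the plane, in the sense of distributions: `u` and `f` are locally integrable and
`-∫ u Δφ = ∫ f φ` for every smooth compactly supported test function `φ`. -/
def SolvesPoisson (u f : Plane → ℝ) : Prop :=
  LocallyIntegrable u volume ∧ LocallyIntegrable f volume ∧
    ∀ φ : Plane → ℝ, ContDiff ℝ ∞ φ → HasCompactSupport φ →
      -∫ x, u x * (Laplacian.laplacian φ : Plane → ℝ) x = ∫ x, f x * φ x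

/-- `K` is bounded on every ball centred at the origin. -/
def IsLocallyBounded (K : Plane → ℝ) : Prop :=
  ∀ R : ℝ, ∃ C : ℝ, ∀ x : Plane, ‖x‖ ≤ R → |K x| ≤ C

/-- A continuous solution `u` of `Δ u + K e^{2u} = 0` in the plane (in the sense of distributions)
with `u(x) = α ln |x| + O(1)` as `|x| → ∞`. -/
def IsLogGrowthSolution (K : Plane → ℝ) (α : ℝ) (u : Plane → ℝ) : Prop :=
  Continuous u ∧
    SolvesPoisson u (fun x => K x * Real.exp (2 * u x)) ∧
    (fun x => u x - α * Real.log ‖x‖) =O[cocompact Plane] (fun _ => (1 : ℝ))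

/-! Everything about infinity rests on the logarithmic cutoff `logCutoff L`. As log ‖x‖ is harmonic
off the origin, the Laplacian of this cutoff is O(1/(L r)²) on e^L ≤ r ≤ e^{2L}, so its L¹ norm is
O(1/L), while its pairing with log ‖x‖ is exactly 2π. Hence functions bounded near infinity pair to
zero with it as L grows. For u = α log ‖x‖ + O(1) with Δu ≥ 0 this yields ∫ Δu = 2πα, which is the
total curvature (`WeakLap.integral_eq_of_log_growth`).

Uniqueness. The difference w of two solutions is bounded, and w Δw ≥ 0 because K ≤ 0 and exp is
increasing. Since Δ(w²) ≥ 2 w Δw, the cutoffs force w Δw = 0 a.e. (`WeakLap.mul_ae_eq_zero`). Then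
Δw = 0, and w is constant by a Liouville theorem proved with the same device. A nonzero constant
would force K = 0 a.e., against a total curvature of −2πα ≠ 0.

Existence. Put u = α w₀ + v + y and q = −K e^{2αw₀} ≥ 0. The equation becomes Δy = q (e^{2(y+v)} −
e^{2t}), for which the constants ±(sup |v| + |t|) are barriers. After truncating q to a ball and
adding a term ε y, it reads (l + ε − Δ) y = l y − q (e^{2(y+v)} − e^{2t}), with l so large that the
right side is increasing in y between the barriers. The resolvent kernel, a Laplace transform of the
heat kernel, turns this into a contraction (`exists_weakLap_regularized`). The bound on y depends
neither on the ball nor on ε, so compactness gives the limit (`exists_weakLap_exponential`).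
Compactness comes from `equicontinuous_of_weakLap`: averages against dilates of Δw₀/2π converge at a
geometric rate controlled by local bounds of the Laplacian. The same estimate provides a continuous
representative of v. -/

/-! ### Calculus of the Laplacian and Green's identity -/

/-- The Laplacian of a real function on the plane. -/
noncomputable abbrev lap (f : Plane → ℝ) : Plane → ℝ := Laplacian.laplacian f

/-- The standard basis of the plane. -/
noncomputable abbrev stdVec (i : Fin 2) : Plane := EuclideanSpace.basisFun (Fin 2) ℝ i

theorem lap_eq {f : Plane → ℝ} {x : Plane} (hf : ContDiffAt ℝ 2 f x) :
    lap f x = ∑ i, fderiv ℝ (fun y => fderiv ℝ f y (stdVec i)) x (stdVec i) := by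
  unfold lap
  rw [InnerProductSpace.laplacian_eq_iteratedFDeriv_orthonormalBasis f
    (EuclideanSpace.basisFun (Fin 2) ℝ)]
  refine Finset.sum_congr rfl fun i _ => ?_
  have hd : DifferentiableAt ℝ (fderiv ℝ f) x :=
    (hf.fderiv_right (m := 1) (by norm_num)).differentiableAt (by norm_num)
  rw [iteratedFDeriv_two_apply, fderiv_clm_apply hd (differentiableAt_const _)]
  simp

theorem lap_comp {f : Plane → ℝ} {β : ℝ → ℝ} {x : Plane} (hf : ContDiffAt ℝ 2 f x)
    (hβ : ContDiffAt ℝ 2 β (f x)) :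
    lap (fun y => β (f y)) x = deriv (deriv β) (f x) * ∑ i, (fderiv ℝ f x (stdVec i)) ^ 2 +
      deriv β (f x) * lap f x := by
  rw [lap_eq hf, lap_eq (f := fun y => β (f y)) (hβ.comp x hf), Finset.mul_sum,
    Finset.mul_sum, ← Finset.sum_add_distrib]
  refine Finset.sum_congr rfl fun i _ => ?_
  have h1 : ∀ᶠ y in nhds x, fderiv ℝ (fun y => β (f y)) y (stdVec i) =
      deriv β (f y) * fderiv ℝ f y (stdVec i) := by
    have hb := hf.continuousAt.eventually (hβ.eventually (by simp))
    filter_upwards [hf.eventually (by simp), hb] with y hy hby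
    have := (hby.differentiableAt (by norm_num)).hasDerivAt.comp_hasFDerivAt y
      (hy.differentiableAt (by norm_num)).hasFDerivAt
    have h0 : fderiv ℝ (fun y => β (f y)) y = _ := this.fderiv
    rw [h0]
    simp
  rw [Filter.EventuallyEq.fderiv_eq h1]
  have hdβ : DifferentiableAt ℝ (deriv β) (f x) := by
    have h2 : ContDiffAt ℝ 1 (fderiv ℝ β) (f x) := hβ.fderiv_right (by norm_num)
    have h3 := (h2.differentiableAt (by norm_num)).clm_apply (differentiableAt_const (1 : ℝ))
    exact h3
  have hf1 := hf.differentiableAt (by norm_num)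
  have hd : DifferentiableAt ℝ (fun y => fderiv ℝ f y (stdVec i)) x :=
    ((hf.fderiv_right (m := 1) (by norm_num)).differentiableAt (by norm_num)).clm_apply
      (differentiableAt_const _)
  have h4 := (hdβ.hasDerivAt.comp_hasFDerivAt x hf1.hasFDerivAt).mul hd.hasFDerivAt
  have h5 : fderiv ℝ (fun y => deriv β (f y) * fderiv ℝ f y (stdVec i)) x = _ := h4.fderiv
  rw [h5]
  simp
  ring

theorem fderiv_norm_sq_stdVec (x : Plane) (i : Fin 2) :
    fderiv ℝ (fun y : Plane => ‖y‖ ^ 2) x (stdVec i) = 2 * x i := by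
  have := (hasStrictFDerivAt_norm_sq x).hasFDerivAt.fderiv
  rw [this]
  simp [stdVec, EuclideanSpace.inner_single_right]

theorem lap_norm_sq (x : Plane) : lap (fun y : Plane => ‖y‖ ^ 2) x = 4 := by
  rw [lap_eq (contDiff_norm_sq ℝ).contDiffAt]
  have h : ∀ i : Fin 2, fderiv ℝ (fun y : Plane => 2 * y i) x (stdVec i) = 2 := by
    intro i
    have h1 : HasFDerivAt (fun y : Plane => 2 * y i)
        ((2 : ℝ) • (EuclideanSpace.proj i : Plane →L[ℝ] ℝ)) x :=
      ((EuclideanSpace.proj i : Plane →L[ℝ] ℝ).hasFDerivAt).const_mul 2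
    rw [h1.fderiv]
    simp [stdVec]
  simp only [fderiv_norm_sq_stdVec, h]
  norm_num

/-- The profile is a function of ‖x‖² rather than ‖x‖, so the inner function is smooth at the origin
too and the chain rule applies everywhere. -/
theorem lap_radial {g : ℝ → ℝ} {x : Plane} (hg : ContDiffAt ℝ 2 g (‖x‖ ^ 2)) :
    lap (fun y => g (‖y‖ ^ 2)) x =
      4 * (‖x‖ ^ 2 * deriv (deriv g) (‖x‖ ^ 2) + deriv g (‖x‖ ^ 2)) := by
  rw [lap_comp (f := fun y => ‖y‖ ^ 2) (contDiff_norm_sq ℝ).contDiffAt hg, lap_norm_sq]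
  simp only [fderiv_norm_sq_stdVec]
  have : ‖x‖ ^ 2 = x 0 ^ 2 + x 1 ^ 2 := by
    rw [EuclideanSpace.real_norm_sq_eq]; simp
  have h2 : ∑ i : Fin 2, (2 * x i) ^ 2 = 4 * ‖x‖ ^ 2 := by
    rw [this]; simp; ring
  rw [h2]; ring

theorem contDiff_fderiv_stdVec {f : Plane → ℝ} (hf : ContDiff ℝ ∞ f) (i : Fin 2) :
    ContDiff ℝ ∞ (fun y => fderiv ℝ f y (stdVec i)) :=
  (hf.fderiv_right (m := ∞) (by norm_cast)).clm_apply contDiff_const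

theorem ContDiff.two_of_smooth {f : Plane → ℝ} (hf : ContDiff ℝ ∞ f) : ContDiff ℝ 2 f :=
  hf.of_le (by norm_cast)

theorem lap_eq_fun {f : Plane → ℝ} (hf : ContDiff ℝ ∞ f) :
    lap f = fun x => ∑ i, fderiv ℝ (fun y => fderiv ℝ f y (stdVec i)) x (stdVec i) :=
  funext fun _ => lap_eq hf.two_of_smooth.contDiffAt

theorem ContDiff.lap {f : Plane → ℝ} (hf : ContDiff ℝ ∞ f) : ContDiff ℝ ∞ (lap f) := by
  rw [lap_eq_fun hf]
  exact ContDiff.sum fun i _ => contDiff_fderiv_stdVec (contDiff_fderiv_stdVec hf i) i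

theorem lap_eq_zero_of_eventuallyEq_const {f : Plane → ℝ} {x : Plane} {c : ℝ}
    (h : f =ᶠ[nhds x] fun _ => c) : lap f x = 0 := by
  have := (InnerProductSpace.laplacian_congr_nhds h).eq_of_nhds
  unfold _root_.lap
  rw [this]
  simp

theorem tsupport_lap_subset (f : Plane → ℝ) : tsupport (lap f) ⊆ tsupport f := by
  refine closure_minimal ?_ (isClosed_tsupport f)
  intro x hx
  by_contra h
  exact hx (lap_eq_zero_of_eventuallyEq_const (c := 0) (notMem_tsupport_iff_eventuallyEq.1 h))

theorem HasCompactSupport.lap {f : Plane → ℝ} (hf : HasCompactSupport f) :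
    HasCompactSupport (lap f) :=
  hf.of_isClosed_subset (isClosed_tsupport _) (tsupport_lap_subset f)

/-- Needed for reflections (c = −1) and translations (c = 1) in convolutions, and for dilations c =
2^k of the regularizing kernels. -/
theorem lap_comp_affine {f : Plane → ℝ} (hf : ContDiff ℝ ∞ f) (a : Plane) (c : ℝ) (x : Plane) :
    lap (fun y => f (a + c • y)) x = c ^ 2 * lap f (a + c • x) := by
  have key : ∀ {g : Plane → ℝ} (_ : ContDiff ℝ ∞ g) (y v : Plane),
      fderiv ℝ (fun y => g (a + c • y)) y v = c * fderiv ℝ g (a + c • y) v := by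
    intro g hg y v
    have h1 : HasFDerivAt (fun y : Plane => a + c • y) (c • ContinuousLinearMap.id ℝ Plane) y :=
      ((hasFDerivAt_id y).const_smul c).const_add a
    have h2 := ((hg.differentiable (by simp)) (a + c • y)).hasFDerivAt.comp y h1
    have h3 : fderiv ℝ (fun y => g (a + c • y)) y = _ := h2.fderiv
    rw [h3]; simp
  have hg : ContDiff ℝ ∞ (fun y => f (a + c • y)) := by fun_prop
  rw [lap_eq hg.two_of_smooth.contDiffAt, lap_eq hf.two_of_smooth.contDiffAt, Finset.mul_sum]
  refine Finset.sum_congr rfl fun i _ => ?_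
  simp only [key hf]
  have hd := contDiff_fderiv_stdVec hf i
  have hd2 : DifferentiableAt ℝ (fun y => fderiv ℝ f (a + c • y) (stdVec i)) x := by
    have : ContDiff ℝ ∞ (fun y => fderiv ℝ f (a + c • y) (stdVec i)) :=
      hd.comp (g := fun y => fderiv ℝ f y (stdVec i)) (f := fun y : Plane => a + c • y)
        (by fun_prop)
    exact this.differentiable (by simp) x
  rw [fderiv_const_mul hd2]
  simp only [smul_apply, smul_eq_mul]
  rw [key hd]
  ring

theorem integral_mul_fderiv_stdVec {f φ : Plane → ℝ} (hf : ContDiff ℝ ∞ f) (hφ : ContDiff ℝ ∞ φ)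
    (hc : HasCompactSupport φ) (i : Fin 2) :
    ∫ x, f x * fderiv ℝ φ x (stdVec i) = -∫ x, fderiv ℝ f x (stdVec i) * φ x := by
  have hc' : HasCompactSupport (fun x => fderiv ℝ φ x (stdVec i)) := hc.fderiv_apply (𝕜 := ℝ) _
  have c1 := hf.continuous
  have c2 := hφ.continuous
  have c3 := (contDiff_fderiv_stdVec hf i).continuous
  have c4 := (contDiff_fderiv_stdVec hφ i).continuous
  apply integral_mul_fderiv_eq_neg_fderiv_mul_of_integrable
  · exact (c3.mul c2).integrable_of_hasCompactSupport hc.mul_left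
  · exact (c1.mul c4).integrable_of_hasCompactSupport hc'.mul_left
  · exact (c1.mul c2).integrable_of_hasCompactSupport hc.mul_left
  · exact fun x _ => hf.differentiable (by simp) x
  · exact fun x _ => hφ.differentiable (by simp) x

/-- Green's second identity against a test function. -/
theorem integral_mul_lap {f φ : Plane → ℝ} (hf : ContDiff ℝ ∞ f) (hφ : ContDiff ℝ ∞ φ)
    (hc : HasCompactSupport φ) : ∫ x, f x * lap φ x = ∫ x, lap f x * φ x := by
  rw [lap_eq_fun hf, lap_eq_fun hφ]
  simp only [Finset.mul_sum, Finset.sum_mul]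
  have hc' : ∀ i, HasCompactSupport (fun x => fderiv ℝ φ x (stdVec i)) :=
    fun i => hc.fderiv_apply (𝕜 := ℝ) _
  have hφ' := contDiff_fderiv_stdVec hφ
  have hf' := contDiff_fderiv_stdVec hf
  rw [integral_finsetSum, integral_finsetSum]
  · refine Finset.sum_congr rfl fun i _ => ?_
    rw [integral_mul_fderiv_stdVec hf (hφ' i) (hc' i), integral_mul_fderiv_stdVec (hf' i) hφ hc,
      neg_neg]
  · exact fun i _ => ((contDiff_fderiv_stdVec (hf' i) i).continuous.mul
      hφ.continuous).integrable_of_hasCompactSupport hc.mul_left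
  · exact fun i _ => (hf.continuous.mul (contDiff_fderiv_stdVec
      (hφ' i) i).continuous).integrable_of_hasCompactSupport
        ((hc' i).fderiv_apply (𝕜 := ℝ) _).mul_left

/-! ### The logarithmic cutoff -/

/-- A smooth step on the line, equal to `1` on `(-∞, 1]` and to `0` on `[2, ∞)`. -/
noncomputable def step (s : ℝ) : ℝ := Real.smoothTransition (2 - s)

theorem contDiff_step : ContDiff ℝ ∞ step :=
  Real.smoothTransition.contDiff.comp (contDiff_const.sub contDiff_id)

theorem step_of_le {s : ℝ} (h : s ≤ 1) : step s = 1 :=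
  Real.smoothTransition.one_of_one_le (by linarith)

theorem step_of_ge {s : ℝ} (h : 2 ≤ s) : step s = 0 :=
  Real.smoothTransition.zero_of_nonpos (by linarith)

theorem step_nonneg (s : ℝ) : 0 ≤ step s := Real.smoothTransition.nonneg _

theorem step_le_one (s : ℝ) : step s ≤ 1 := Real.smoothTransition.le_one _

theorem contDiff_deriv_step : ContDiff ℝ ∞ (deriv step) :=
  (contDiff_infty_iff_deriv.1 contDiff_step).2

theorem contDiff_deriv_deriv_step : ContDiff ℝ ∞ (deriv (deriv step)) :=
  (contDiff_infty_iff_deriv.1 contDiff_deriv_step).2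

theorem deriv_step_of_lt {s : ℝ} (h : s < 1) : deriv step s = 0 := by
  have : step =ᶠ[nhds s] fun _ => 1 := by
    filter_upwards [Iio_mem_nhds h] with t ht using step_of_le ht.le
  rw [this.deriv_eq]; simp

theorem deriv_step_of_gt {s : ℝ} (h : 2 < s) : deriv step s = 0 := by
  have : step =ᶠ[nhds s] fun _ => 0 := by
    filter_upwards [Ioi_mem_nhds h] with t ht using step_of_ge (le_of_lt ht)
  rw [this.deriv_eq]; simp

theorem deriv_deriv_step_of_lt {s : ℝ} (h : s < 1) : deriv (deriv step) s = 0 := by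
  have : deriv step =ᶠ[nhds s] fun _ => 0 := by
    filter_upwards [Iio_mem_nhds h] with t ht using deriv_step_of_lt ht
  rw [this.deriv_eq]; simp

theorem deriv_deriv_step_of_gt {s : ℝ} (h : 2 < s) : deriv (deriv step) s = 0 := by
  have : deriv step =ᶠ[nhds s] fun _ => 0 := by
    filter_upwards [Ioi_mem_nhds h] with t ht using deriv_step_of_gt ht
  rw [this.deriv_eq]; simp

theorem exists_bound_deriv_deriv_step : ∃ M, 0 < M ∧ ∀ s, |deriv (deriv step) s| ≤ M := by
  have hc : HasCompactSupport (deriv (deriv step)) := by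
    refine HasCompactSupport.intro (isCompact_Icc (a := (1 : ℝ)) (b := 2)) fun s hs => ?_
    rcases lt_or_ge s 1 with h | h
    · exact deriv_deriv_step_of_lt h
    · exact deriv_deriv_step_of_gt (by by_contra h'; exact hs ⟨h, not_lt.1 h'⟩)
  obtain ⟨M, hM⟩ := hc.exists_bound_of_continuous contDiff_deriv_deriv_step.continuous
  exact ⟨max M 1, by positivity, fun s => (hM s).trans (le_max_left _ _)⟩

/-- The logarithmic cutoff: `1` on the ball of radius `e^L`, `0` outside the ball of radius
`e^{2L}`, with Laplacian small in `L¹`. -/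
noncomputable def logCutoff (L : ℝ) (x : Plane) : ℝ := step (Real.log (‖x‖ ^ 2) / (2 * L))

theorem logCutoff_nonneg (L : ℝ) (x : Plane) : 0 ≤ logCutoff L x := step_nonneg _

theorem logCutoff_le_one (L : ℝ) (x : Plane) : logCutoff L x ≤ 1 := step_le_one _

theorem log_norm_sq_div (L : ℝ) (x : Plane) :
    Real.log (‖x‖ ^ 2) / (2 * L) = Real.log ‖x‖ / L := by
  rw [Real.log_pow]; push_cast; rw [mul_div_mul_left _ _ two_ne_zero]

theorem logCutoff_eq_one {L : ℝ} (hL : 0 < L) {x : Plane} (hx : ‖x‖ ≤ Real.exp L) :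
    logCutoff L x = 1 := by
  rw [logCutoff, log_norm_sq_div]
  refine step_of_le ?_
  rw [div_le_one hL]
  rcases (norm_nonneg x).eq_or_lt with h | h
  · rw [← h]; simpa using hL.le
  · rwa [Real.log_le_iff_le_exp h]

theorem logCutoff_eq_zero {L : ℝ} (hL : 0 < L) {x : Plane} (hx : Real.exp (2 * L) ≤ ‖x‖) :
    logCutoff L x = 0 := by
  rw [logCutoff, log_norm_sq_div]
  refine step_of_ge ?_
  rw [le_div_iff₀ hL, Real.le_log_iff_exp_le ((Real.exp_pos _).trans_le hx)]
  exact hx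

theorem logCutoff_eventuallyEq_one {L : ℝ} (hL : 0 < L) {x : Plane} (hx : ‖x‖ < Real.exp L) :
    logCutoff L =ᶠ[nhds x] fun _ => 1 := by
  filter_upwards [continuous_norm.continuousAt.eventually (Iio_mem_nhds hx)] with y hy
  exact logCutoff_eq_one hL (le_of_lt hy)

theorem contDiff_logCutoff {L : ℝ} (hL : 0 < L) : ContDiff ℝ ∞ (logCutoff L) := by
  rw [contDiff_iff_contDiffAt]
  intro x
  by_cases hx : x = 0
  · subst hx
    exact contDiffAt_const.congr_of_eventuallyEq
      (logCutoff_eventuallyEq_one hL (by simpa using Real.exp_pos L))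
  · have h1 : ContDiffAt ℝ ∞ (fun y : Plane => Real.log (‖y‖ ^ 2) / (2 * L)) x :=
      ((contDiff_norm_sq ℝ).contDiffAt.log (by simpa using hx)).div_const _
    exact contDiff_step.contDiffAt.comp x h1

theorem hasCompactSupport_logCutoff {L : ℝ} (hL : 0 < L) : HasCompactSupport (logCutoff L) := by
  refine HasCompactSupport.intro (isCompact_closedBall (0 : Plane) (Real.exp (2 * L)))
    fun x hx => logCutoff_eq_zero hL ?_
  simpa using (not_le.1 (by simpa using hx : ¬ ‖x‖ ≤ Real.exp (2 * L))).le

/-- The radial profile of the Laplacian of the logarithmic cutoff. -/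
noncomputable def logCutoffProfile (L r : ℝ) : ℝ :=
  deriv (deriv step) (Real.log r / L) / (L ^ 2 * r ^ 2)

/-- Only the second derivative of `step` survives: the first-order term would carry the Laplacian of
log ‖x‖, which vanishes off the origin. Near the origin both sides are zero. -/
theorem lap_logCutoff {L : ℝ} (hL : 0 < L) (x : Plane) :
    lap (logCutoff L) x = logCutoffProfile L ‖x‖ := by
  rw [logCutoffProfile]
  by_cases hx : x = 0
  · subst hx
    rw [lap_eq_zero_of_eventuallyEq_const
      (logCutoff_eventuallyEq_one hL (by simpa using Real.exp_pos L))]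
    simp
  have hs : 0 < ‖x‖ ^ 2 := by positivity
  have hd1 : ∀ s : ℝ, 0 < s → HasDerivAt (fun s => step (Real.log s / (2 * L)))
      (deriv step (Real.log s / (2 * L)) * (s⁻¹ / (2 * L))) s := fun s hs =>
    ((contDiff_step.differentiable (by simp)) _).hasDerivAt.comp s
      ((Real.hasDerivAt_log hs.ne').div_const _)
  have hd1' : deriv (fun s => step (Real.log s / (2 * L))) =ᶠ[nhds (‖x‖ ^ 2)]
      fun s => deriv step (Real.log s / (2 * L)) * (s⁻¹ / (2 * L)) := by
    filter_upwards [Ioi_mem_nhds hs] with s hs using (hd1 s hs).deriv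
  have hd2 : HasDerivAt (fun s => deriv step (Real.log s / (2 * L)) * (s⁻¹ / (2 * L))) _
      (‖x‖ ^ 2) :=
    (((contDiff_deriv_step.differentiable (by simp)) _).hasDerivAt.comp (‖x‖ ^ 2)
      ((Real.hasDerivAt_log hs.ne').div_const (2 * L))).mul
      ((hasDerivAt_inv hs.ne').div_const (2 * L))
  have hcd : ContDiffAt ℝ 2 (fun s => step (Real.log s / (2 * L))) (‖x‖ ^ 2) := by
    have h1 : ContDiffAt ℝ 2 (fun s => Real.log s / (2 * L)) (‖x‖ ^ 2) :=
      (Real.contDiffAt_log.2 hs.ne').div_const _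
    exact ((contDiff_step.of_le (by norm_cast)).contDiffAt).comp (‖x‖ ^ 2) h1
  have := lap_radial (x := x) hcd
  change lap (fun y => step (Real.log (‖y‖ ^ 2) / (2 * L))) x = _
  rw [this, hd1'.deriv_eq, hd2.deriv, hd1'.eq_of_nhds]
  simp only [Function.comp, log_norm_sq_div]
  field_simp
  ring

theorem logCutoffProfile_eq_zero {L r : ℝ} (hL : 0 < L) (hr : 0 < r)
    (h : r ∉ Set.Icc (Real.exp L) (Real.exp (2 * L))) : logCutoffProfile L r = 0 := by
  rw [logCutoffProfile]
  rcases lt_or_ge r (Real.exp L) with h1 | h1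
  · rw [deriv_deriv_step_of_lt, zero_div]
    rw [div_lt_one hL]; exact (Real.log_lt_iff_lt_exp hr).2 h1
  · rw [deriv_deriv_step_of_gt, zero_div]
    rw [lt_div_iff₀ hL, Real.lt_log_iff_exp_lt hr]
    by_contra h'; exact h ⟨h1, not_lt.1 h'⟩

theorem integral_radial (f : ℝ → ℝ) :
    ∫ x : Plane, f ‖x‖ = 2 * Real.pi * ∫ r in Set.Ioi (0 : ℝ), r * f r := by
  have := integral_fun_norm_addHaar (volume : Measure Plane) f
  rw [this]
  simp [measureReal_def, EuclideanSpace.volume_ball_fin_two, mul_assoc, Real.pi_pos.le]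

theorem integral_inv_exp {L : ℝ} (h : 0 ≤ L) :
    ∫ r in Set.Icc (Real.exp L) (Real.exp (2 * L)), r⁻¹ = L := by
  have hle : Real.exp L ≤ Real.exp (2 * L) := Real.exp_le_exp.2 (by linarith)
  rw [integral_Icc_eq_integral_Ioc, ← intervalIntegral.integral_of_le hle,
    integral_inv_of_pos (Real.exp_pos _) (Real.exp_pos _), ← Real.exp_sub, Real.log_exp]
  ring

/-- In polar coordinates the weight r leaves M/(L² r) on [e^L, e^{2L}], and the integral of 1/r
there is L. -/
theorem exists_integral_abs_lap_logCutoff_le :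
    ∃ M, 0 < M ∧ ∀ L : ℝ, 0 < L → ∫ x, |lap (logCutoff L) x| ≤ M / L := by
  obtain ⟨M, hM0, hM⟩ := exists_bound_deriv_deriv_step
  refine ⟨2 * Real.pi * M, by positivity, fun L hL => ?_⟩
  simp only [lap_logCutoff hL]
  rw [integral_radial (fun r => |logCutoffProfile L r|), mul_div_assoc]
  refine mul_le_mul_of_nonneg_left ?_ (by positivity : (0 : ℝ) ≤ 2 * Real.pi)
  set I := Set.Icc (Real.exp L) (Real.exp (2 * L))
  have hinv : ContinuousOn (fun r : ℝ => r⁻¹) I :=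
    continuousOn_id.inv₀ fun r hr => ((Real.exp_pos L).trans_le hr.1).ne'
  have hint : IntegrableOn (fun r : ℝ => M / L ^ 2 * r⁻¹) I :=
    (continuousOn_const.mul hinv).integrableOn_Icc
  have hsub : I ⊆ Set.Ioi (0 : ℝ) := fun r hr => (Real.exp_pos L).trans_le hr.1
  calc ∫ r in Set.Ioi (0 : ℝ), r * |logCutoffProfile L r|
      ≤ ∫ r in Set.Ioi (0 : ℝ), I.indicator (fun r : ℝ => M / L ^ 2 * r⁻¹) r := by
        refine integral_mono_of_nonneg ?_ ?_ ?_
        · filter_upwards [ae_restrict_mem measurableSet_Ioi] with r hr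
          exact mul_nonneg (le_of_lt hr) (abs_nonneg _)
        · exact ((integrable_indicator_iff measurableSet_Icc).2 hint).integrableOn
        · filter_upwards [ae_restrict_mem measurableSet_Ioi] with r hr
          have hr : 0 < r := hr
          by_cases h : r ∈ I
          · rw [Set.indicator_of_mem h, logCutoffProfile, abs_div,
              abs_of_pos (by positivity : 0 < L ^ 2 * r ^ 2)]
            calc r * (|deriv (deriv step) (Real.log r / L)| / (L ^ 2 * r ^ 2))
                ≤ r * (M / (L ^ 2 * r ^ 2)) := by gcongr; exact hM _
              _ = M / L ^ 2 * r⁻¹ := by field_simp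
          · rw [Set.indicator_of_notMem h, logCutoffProfile_eq_zero hL hr h]; simp
    _ = M / L := by
        rw [setIntegral_indicator measurableSet_Icc, Set.inter_eq_self_of_subset_right hsub,
          integral_const_mul, integral_inv_exp hL.le]
        field_simp

/-- The radial integrand is an exact derivative, so only the endpoint values of its primitive
matter; they do not depend on L. -/
theorem integral_log_mul_lap_logCutoff {L : ℝ} (hL : 0 < L) :
    ∫ x, Real.log ‖x‖ * lap (logCutoff L) x = 2 * Real.pi := by
  simp only [lap_logCutoff hL]
  rw [integral_radial (fun r => Real.log r * logCutoffProfile L r)]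
  set I := Set.Icc (Real.exp L) (Real.exp (2 * L))
  -- With s = log r / L, the derivative of s step'(s) − step(s) in s is s step''(s). This primitive
  -- goes from −1 near r = 0 to 0 at infinity.
  set H : ℝ → ℝ := fun r => Real.log r / L * deriv step (Real.log r / L) - step (Real.log r / L)
  have hzero : ∀ r ∈ Set.Ioi (0 : ℝ), r ∉ I → r * (Real.log r * logCutoffProfile L r) = 0 :=
    fun r hr h => by rw [logCutoffProfile_eq_zero hL hr h]; simp
  have hder : ∀ r ∈ Set.Ioi (0 : ℝ),
      HasDerivAt H (r * (Real.log r * logCutoffProfile L r)) r := by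
    intro r hr
    have hr : 0 < r := hr
    have hl := (Real.hasDerivAt_log hr.ne').div_const L
    have h1 :=
      ((contDiff_deriv_step.differentiable (by simp)) (Real.log r / L)).hasDerivAt.comp r hl
    have h2 := ((contDiff_step.differentiable (by simp)) (Real.log r / L)).hasDerivAt.comp r hl
    refine ((hl.mul h1).sub h2).congr_deriv ?_
    simp only [Function.comp, logCutoffProfile]
    field_simp
    ring
  -- The case r = 0 is covered because `Real.log 0 = 0`; this gives continuity at the left endpoint.
  have hlow : ∀ r : ℝ, 0 ≤ r → r < 1 → H r = -1 := by
    intro r h0 h1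
    have hlt : Real.log r / L < 1 := by
      rw [div_lt_one hL]
      exact (Real.log_nonpos h0 h1.le).trans_lt hL
    simp [H, deriv_step_of_lt hlt, step_of_le hlt.le]
  have hint : IntegrableOn (fun r => r * (Real.log r * logCutoffProfile L r)) (Set.Ioi 0) := by
    have : IntegrableOn (fun r => r * (Real.log r * logCutoffProfile L r)) I := by
      refine ContinuousOn.integrableOn_Icc ?_
      have hlog : ContinuousOn Real.log I := Real.continuousOn_log.mono fun r hr =>
        ((Real.exp_pos _).trans_le hr.1).ne'
      unfold logCutoffProfile
      refine continuousOn_id.mul (hlog.mul (ContinuousOn.div ?_ (by fun_prop) fun r hr => ?_))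
      · exact contDiff_deriv_deriv_step.continuous.comp_continuousOn (hlog.div_const L)
      · have : 0 < r := (Real.exp_pos _).trans_le hr.1
        positivity
    have h2 := (integrable_indicator_iff measurableSet_Icc).2 this
    refine (h2.integrableOn (s := Set.Ioi 0)).congr_fun (fun r hr => ?_) measurableSet_Ioi
    by_cases h : r ∈ I
    · rw [Set.indicator_of_mem h]
    · rw [Set.indicator_of_notMem h, hzero r hr h]
  have := integral_Ioi_of_hasDerivAt_of_tendsto (a := (0 : ℝ)) (m := 0) (f := H) ?_ hder hint ?_
  · rw [this, hlow 0 le_rfl one_pos]; ring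
  · refine (continuousWithinAt_const (b := (-1 : ℝ))).congr_of_eventuallyEq ?_
      (hlow 0 le_rfl one_pos)
    filter_upwards [self_mem_nhdsWithin, mem_nhdsWithin_of_mem_nhds (Iio_mem_nhds one_pos)]
      with r h0 h1 using hlow r h0 h1
  · refine tendsto_const_nhds.congr' ?_
    filter_upwards [eventually_gt_atTop (Real.exp (2 * L))] with r hr
    have hgt : 2 < Real.log r / L := by
      rw [lt_div_iff₀ hL, Real.lt_log_iff_exp_lt ((Real.exp_pos _).trans hr)]; exact hr
    simp [H, deriv_step_of_gt hgt, step_of_ge hgt.le]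

/-! ### Weak Laplace equations and mollification -/

/-- `Δ u = f` in the sense of distributions. -/
def WeakLap (u f : Plane → ℝ) : Prop :=
  LocallyIntegrable u volume ∧ LocallyIntegrable f volume ∧
    ∀ φ : Plane → ℝ, ContDiff ℝ ∞ φ → HasCompactSupport φ → ∫ x, u x * lap φ x = ∫ x, f x * φ x

theorem solvesPoisson_iff_weakLap {u f : Plane → ℝ} :
    SolvesPoisson u f ↔ WeakLap u (fun x => -f x) := by
  unfold SolvesPoisson WeakLap
  have hl : LocallyIntegrable f volume ↔ LocallyIntegrable (fun x => -f x) volume :=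
    ⟨fun h => h.neg, fun h => by
      simpa using (show LocallyIntegrable (fun x => - -f x) volume from h.neg)⟩
  rw [hl]
  refine and_congr_right fun _ => and_congr_right fun _ => forall_congr' fun φ =>
    imp_congr_right fun _ => imp_congr_right fun _ => ?_
  simp only [neg_mul, integral_neg]
  exact neg_eq_iff_eq_neg

theorem LocallyIntegrable.integrable_mul_test {f φ : Plane → ℝ} (hf : LocallyIntegrable f volume)
    (hφ : Continuous φ) (hc : HasCompactSupport φ) : Integrable (fun x => f x * φ x) := by
  simpa [mul_comm] using hf.integrable_smul_left_of_hasCompactSupport hφ hc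

theorem WeakLap.sub {u f u' f' : Plane → ℝ} (h : WeakLap u f) (h' : WeakLap u' f') :
    WeakLap (fun x => u x - u' x) (fun x => f x - f' x) := by
  refine ⟨h.1.sub h'.1, h.2.1.sub h'.2.1, fun φ hφ hc => ?_⟩
  simp only [sub_mul]
  rw [integral_sub (LocallyIntegrable.integrable_mul_test h.1 hφ.lap.continuous hc.lap)
    (LocallyIntegrable.integrable_mul_test h'.1 hφ.lap.continuous hc.lap),
    integral_sub (LocallyIntegrable.integrable_mul_test h.2.1 hφ.continuous hc)
    (LocallyIntegrable.integrable_mul_test h'.2.1 hφ.continuous hc), h.2.2 φ hφ hc, h'.2.2 φ hφ hc]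

theorem WeakLap.add {u f u' f' : Plane → ℝ} (h : WeakLap u f) (h' : WeakLap u' f') :
    WeakLap (fun x => u x + u' x) (fun x => f x + f' x) := by
  refine ⟨h.1.add h'.1, h.2.1.add h'.2.1, fun φ hφ hc => ?_⟩
  simp only [add_mul]
  rw [integral_add (LocallyIntegrable.integrable_mul_test h.1 hφ.lap.continuous hc.lap)
    (LocallyIntegrable.integrable_mul_test h'.1 hφ.lap.continuous hc.lap),
    integral_add (LocallyIntegrable.integrable_mul_test h.2.1 hφ.continuous hc)
    (LocallyIntegrable.integrable_mul_test h'.2.1 hφ.continuous hc), h.2.2 φ hφ hc, h'.2.2 φ hφ hc]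

theorem WeakLap.congr_ae {u f u' f' : Plane → ℝ} (h : WeakLap u f)
    (hu : u =ᵐ[volume] u') (hf : f =ᵐ[volume] f') : WeakLap u' f' := by
  refine ⟨h.1.congr hu, h.2.1.congr hf, fun φ hφ hc => ?_⟩
  have h1 : ∫ x, u' x * lap φ x = ∫ x, u x * lap φ x :=
    integral_congr_ae (by filter_upwards [hu] with x hx; rw [hx])
  have h2 : ∫ x, f' x * φ x = ∫ x, f x * φ x :=
    integral_congr_ae (by filter_upwards [hf] with x hx; rw [hx])
  rw [h1, h2, h.2.2 φ hφ hc]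

theorem ContDiff.weakLap {w : Plane → ℝ} (hw : ContDiff ℝ ∞ w) : WeakLap w (_root_.lap w) :=
  ⟨hw.continuous.locallyIntegrable, hw.lap.continuous.locallyIntegrable,
    fun _ hφ hc => integral_mul_lap hw hφ hc⟩

theorem WeakLap.const_mul {u f : Plane → ℝ} (h : WeakLap u f) (a : ℝ) :
    WeakLap (fun x => a * u x) (fun x => a * f x) := by
  refine ⟨h.1.smul a, h.2.1.smul a, fun φ hφ hc => ?_⟩
  simp only [mul_assoc, integral_const_mul]
  rw [h.2.2 φ hφ hc]

/-- The convolution of `f` with the kernel `ψ`. -/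
noncomputable def mollify (ψ f : Plane → ℝ) (x : Plane) : ℝ := ∫ y, f y * ψ (x - y)

theorem mollify_eq_convolution (ψ f : Plane → ℝ) :
    mollify ψ f = convolution f ψ (ContinuousLinearMap.mul ℝ ℝ) volume := rfl

/-- The convergence theorems for bumps want the kernel as left factor, the differentiation theorems
as right factor. -/
theorem mollify_eq_convolution_swap (ψ f : Plane → ℝ) :
    mollify ψ f = convolution ψ f (ContinuousLinearMap.lsmul ℝ ℝ) volume := by
  ext x
  rw [convolution_eq_swap]
  exact integral_congr_ae (.of_forall fun y => by simp [mul_comm])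

theorem contDiff_mollify {ψ f : Plane → ℝ} (hψ : ContDiff ℝ ∞ ψ) (hc : HasCompactSupport ψ)
    (hf : LocallyIntegrable f volume) : ContDiff ℝ ∞ (mollify ψ f) :=
  hc.contDiff_convolution_right (ContinuousLinearMap.mul ℝ ℝ) hf hψ

theorem fderiv_mollify {ψ f : Plane → ℝ} (hψ : ContDiff ℝ ∞ ψ) (hc : HasCompactSupport ψ)
    (hf : LocallyIntegrable f volume) (x v : Plane) :
    fderiv ℝ (mollify ψ f) x v = mollify (fun z => fderiv ℝ ψ z v) f x := by
  have h := (hc.hasFDerivAt_convolution_right (ContinuousLinearMap.mul ℝ ℝ) hf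
    (hψ.of_le (by norm_cast)) x).fderiv
  rw [mollify_eq_convolution, h, convolution_precompR_apply _ hf (hc.fderiv ℝ)
    (hψ.continuous_fderiv (by simp))]
  rfl

theorem lap_mollify {ψ f : Plane → ℝ} (hψ : ContDiff ℝ ∞ ψ) (hc : HasCompactSupport ψ)
    (hf : LocallyIntegrable f volume) : lap (mollify ψ f) = mollify (lap ψ) f := by
  have hψ' := contDiff_fderiv_stdVec hψ
  have hc' : ∀ i, HasCompactSupport (fun x => fderiv ℝ ψ x (stdVec i)) :=
    fun i => hc.fderiv_apply (𝕜 := ℝ) _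
  ext x
  rw [lap_eq (contDiff_mollify hψ hc hf).two_of_smooth.contDiffAt, lap_eq_fun hψ]
  simp only [fderiv_mollify hψ hc hf, fderiv_mollify (hψ' _) (hc' _) hf]
  unfold mollify
  simp only [Finset.mul_sum]
  rw [integral_finsetSum]
  intro i _
  refine LocallyIntegrable.integrable_mul_test hf
    ((contDiff_fderiv_stdVec (hψ' i) i).continuous.comp (continuous_const.sub continuous_id)) ?_
  exact ((hc' i).fderiv_apply (𝕜 := ℝ) (stdVec i)).comp_homeomorph (Homeomorph.subLeft x)

/-- Use y ↦ ψ(x − y) as test function; the reflection leaves the Laplacian unchanged since (−1)² =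
1. -/
theorem WeakLap.mollify_lap {u f ψ : Plane → ℝ} (h : WeakLap u f) (hψ : ContDiff ℝ ∞ ψ)
    (hc : HasCompactSupport ψ) (x : Plane) : mollify (lap ψ) u x = mollify ψ f x := by
  have h1 := h.2.2 (fun y => ψ (x - y)) (hψ.comp (contDiff_const.sub contDiff_id))
    (hc.comp_homeomorph (Homeomorph.subLeft x))
  have h2 : ∀ y, lap (fun y => ψ (x - y)) y = lap ψ (x - y) := fun y => by
    simpa [← sub_eq_add_neg] using lap_comp_affine hψ x (-1) y
  simp only [h2] at h1
  exact h1

theorem WeakLap.lap_mollify {u f ψ : Plane → ℝ} (h : WeakLap u f) (hψ : ContDiff ℝ ∞ ψ)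
    (hc : HasCompactSupport ψ) : lap (mollify ψ u) = mollify ψ f := by
  rw [_root_.lap_mollify hψ hc h.1]
  exact funext (h.mollify_lap hψ hc)

/-- The gradient term is discarded in `WeakLap.two_mul_integral_le` and is the whole point in the
Liouville theorem. -/
theorem lap_sq {h : Plane → ℝ} (hh : ContDiff ℝ ∞ h) (x : Plane) :
    lap (fun y => h y ^ 2) x = 2 * ∑ i, (fderiv ℝ h x (stdVec i)) ^ 2 + 2 * h x * lap h x := by
  have hd : deriv (fun s : ℝ => s ^ 2) = fun s => 2 * s := by ext s; simp
  rw [lap_comp (β := fun s => s ^ 2) hh.two_of_smooth.contDiffAt (by fun_prop), hd]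
  have : deriv (fun s : ℝ => 2 * s) (h x) = 2 := by
    rw [deriv_const_mul _ differentiableAt_fun_id]; simp
  rw [this]

/-- Smooth bumps of integral one shrinking to the origin. -/
noncomputable def shrinkingBump (n : ℕ) : ContDiffBump (0 : Plane) :=
  ⟨1 / (n + 1), 2 / (n + 1), by positivity, by gcongr; norm_num⟩

/-- The normalized kernel of `shrinkingBump`. -/
noncomputable def bumpKernel (n : ℕ) : Plane → ℝ := (shrinkingBump n).normed volume

theorem tendsto_shrinkingBump_rOut :
    Tendsto (fun n => (shrinkingBump n).rOut) atTop (nhds 0) :=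
  tendsto_const_div_atTop_nhds_zero_nat (2 : ℝ) |>.comp (tendsto_add_atTop_nat 1) |>.congr
    fun n => by simp [shrinkingBump]

theorem shrinkingBump_rOut_le (n : ℕ) : (shrinkingBump n).rOut ≤ 2 := by
  change (2 : ℝ) / (n + 1) ≤ 2
  exact div_le_self (by norm_num) (by linarith [n.cast_nonneg (α := ℝ)])

theorem contDiff_bumpKernel (n : ℕ) : ContDiff ℝ ∞ (bumpKernel n) :=
  (shrinkingBump n).contDiff_normed

theorem hasCompactSupport_bumpKernel (n : ℕ) : HasCompactSupport (bumpKernel n) :=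
  (shrinkingBump n).hasCompactSupport_normed

theorem ae_tendsto_mollify_bumpKernel {f : Plane → ℝ} (hf : LocallyIntegrable f volume) :
    ∀ᵐ x, Tendsto (fun n => mollify (bumpKernel n) f x) atTop (nhds (f x)) := by
  simp only [mollify_eq_convolution_swap]
  -- Convergence at Lebesgue points requires a bounded ratio of outer to inner radius; here it is
  -- always 2.
  refine ContDiffBump.ae_convolution_tendsto_right_of_locallyIntegrable (K := 2)
    tendsto_shrinkingBump_rOut (.of_forall fun n => le_of_eq ?_) hf
  change (2 : ℝ) / (n + 1) = 2 * (1 / (n + 1))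
  ring

theorem tendsto_mollify_bumpKernel {f : Plane → ℝ} (hf : Continuous f) (x : Plane) :
    Tendsto (fun n => mollify (bumpKernel n) f x) atTop (nhds (f x)) := by
  simp only [mollify_eq_convolution_swap]
  exact ContDiffBump.convolution_tendsto_right_of_continuous tendsto_shrinkingBump_rOut hf x

/-- Only the values of f within r of x enter the average, so a local bound is enough. -/
theorem abs_mollify_le {ψ f : Plane → ℝ} {C r : ℝ} {x : Plane} (hψ : Continuous ψ)
    (hs : ∀ z, r < ‖z‖ → ψ z = 0) (hC : ∀ y, ‖y - x‖ ≤ r → |f y| ≤ C) :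
    |mollify ψ f x| ≤ C * ∫ z, |ψ z| := by
  have hc : HasCompactSupport ψ := HasCompactSupport.intro (isCompact_closedBall (0 : Plane) r)
    fun z hz => hs z (by simpa using hz)
  have h1 : ∫ z, |ψ z| = ∫ y, |ψ (x - y)| := (integral_sub_left_eq_self (fun z => |ψ z|) _ x).symm
  rw [h1, ← integral_const_mul]
  refine norm_integral_le_of_norm_le (f := fun y => f y * ψ (x - y)) ?_ (.of_forall fun y => ?_)
  · have hi : Integrable (fun z => |ψ z|) volume := (hψ.integrable_of_hasCompactSupport hc).abs
    exact (hi.comp_sub_left x).const_mul C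
  · rw [Real.norm_eq_abs, abs_mul]
    by_cases hy : ‖y - x‖ ≤ r
    · exact mul_le_mul_of_nonneg_right (hC y hy) (abs_nonneg _)
    · rw [hs (x - y) (by rw [norm_sub_rev]; exact not_le.1 hy)]; simp

theorem bumpKernel_eq_zero {n : ℕ} {z : Plane} (hz : 2 < ‖z‖) : bumpKernel n z = 0 := by
  have : z ∉ Function.support (bumpKernel n) := by
    rw [bumpKernel, ContDiffBump.support_normed_eq]
    simpa using (shrinkingBump_rOut_le n).trans hz.le
  exact Function.notMem_support.1 this

theorem abs_mollify_bumpKernel_le {n : ℕ} {f : Plane → ℝ} {C : ℝ} {x : Plane}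
    (hC : ∀ y, ‖y - x‖ ≤ 2 → |f y| ≤ C) : |mollify (bumpKernel n) f x| ≤ C := by
  have h := abs_mollify_le (contDiff_bumpKernel n).continuous (fun z hz => bumpKernel_eq_zero hz) hC
  have h1 : ∫ z, |bumpKernel n z| = 1 := by
    rw [← (shrinkingBump n).integral_normed (μ := volume)]
    exact integral_congr_ae (.of_forall fun z => abs_of_nonneg ((shrinkingBump n).nonneg_normed z))
  rwa [h1, mul_one] at h

theorem IsLocallyBounded.exists_bound_tsupport {F φ : Plane → ℝ} (hF : IsLocallyBounded F)
    (hc : HasCompactSupport φ) :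
    ∃ M, 0 ≤ M ∧ ∀ x, φ x ≠ 0 → ∀ y, ‖y - x‖ ≤ 2 → |F y| ≤ M := by
  obtain ⟨R, hR⟩ := hc.isCompact.isBounded.subset_closedBall (0 : Plane)
  -- The margin 2 bounds the support radius of every `bumpKernel`.
  obtain ⟨M, hM⟩ := hF (R + 2)
  refine ⟨max M 0, le_max_right _ _, fun x hx y hy => (hM y ?_).trans (le_max_left _ _)⟩
  have h1 : ‖x‖ ≤ R := by simpa using hR (subset_tsupport _ hx)
  calc ‖y‖ = ‖x + (y - x)‖ := by congr 1; abel
    _ ≤ R + 2 := (norm_add_le _ _).trans (add_le_add h1 hy)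

/-- If `w` is bounded and `Δ w = F` weakly then `Δ (w²) ≥ 2 w F` weakly. -/
theorem WeakLap.two_mul_integral_le {w F φ : Plane → ℝ} {C : ℝ} (h : WeakLap w F)
    (hw : ∀ x, |w x| ≤ C) (hF : IsLocallyBounded F) (hφ : ContDiff ℝ ∞ φ)
    (hc : HasCompactSupport φ) (hφ0 : ∀ x, 0 ≤ φ x) :
    2 * ∫ x, φ x * (w x * F x) ≤ ∫ x, w x ^ 2 * lap φ x := by
  obtain ⟨M, hM0, hM⟩ := hF.exists_bound_tsupport hc
  set W := fun n => mollify (bumpKernel n) w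
  set G := fun n => mollify (bumpKernel n) F
  have hW : ∀ n, ContDiff ℝ ∞ (W n) := fun n =>
    contDiff_mollify (contDiff_bumpKernel n) (hasCompactSupport_bumpKernel n) h.1
  have hG : ∀ n, ContDiff ℝ ∞ (G n) := fun n =>
    contDiff_mollify (contDiff_bumpKernel n) (hasCompactSupport_bumpKernel n) h.2.1
  have hWC : ∀ n x, |W n x| ≤ C := fun n x => abs_mollify_bumpKernel_le fun y _ => hw y
  have hC0 : 0 ≤ C := (abs_nonneg _).trans (hw 0)
  -- For the smooth mollifications the inequality is pointwise: Δ(W²) = 2|∇W|² + 2WG, and φ ≥ 0. The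
  -- limit in n then follows by dominated convergence.
  have hineq : ∀ n, 2 * ∫ x, φ x * (W n x * G n x) ≤ ∫ x, W n x ^ 2 * lap φ x := by
    intro n
    have hsq : ContDiff ℝ ∞ (fun x => W n x ^ 2) := (hW n).pow 2
    rw [integral_mul_lap hsq hφ hc, ← integral_const_mul]
    refine integral_mono ?_ ?_ fun x => ?_
    · exact ((hφ.continuous.mul ((hW n).continuous.mul
        (hG n).continuous)).integrable_of_hasCompactSupport hc.mul_right).const_mul 2
    · exact (hsq.lap.continuous.mul hφ.continuous).integrable_of_hasCompactSupport hc.mul_left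
    · change 2 * (φ x * (W n x * G n x)) ≤ lap (fun x => W n x ^ 2) x * φ x
      rw [lap_sq (hW n), h.lap_mollify (contDiff_bumpKernel n) (hasCompactSupport_bumpKernel n)]
      have : 0 ≤ 2 * ∑ i, (fderiv ℝ (W n) x (stdVec i)) ^ 2 := by positivity
      have h3 := mul_nonneg this (hφ0 x)
      change _ ≤ (_ + 2 * W n x * G n x) * φ x
      linarith
  have lim1 : Tendsto (fun n => ∫ x, φ x * (W n x * G n x)) atTop
      (nhds (∫ x, φ x * (w x * F x))) := by
    refine tendsto_integral_of_dominated_convergence (fun x => φ x * (C * M))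
      (fun n => (hφ.continuous.mul ((hW n).continuous.mul (hG n).continuous)).aestronglyMeasurable)
      ((hφ.continuous.integrable_of_hasCompactSupport hc).mul_const _)
      (fun n => .of_forall fun x => ?_) ?_
    · rw [Real.norm_eq_abs, abs_mul, abs_of_nonneg (hφ0 x), abs_mul]
      by_cases hx : φ x = 0
      · simp [hx]
      · exact mul_le_mul_of_nonneg_left (mul_le_mul (hWC n x)
          (abs_mollify_bumpKernel_le (hM x hx)) (abs_nonneg _) hC0) (hφ0 x)
    · filter_upwards [ae_tendsto_mollify_bumpKernel h.1, ae_tendsto_mollify_bumpKernel h.2.1]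
        with x h1 h2 using (h1.mul h2).const_mul _
  have lim2 : Tendsto (fun n => ∫ x, W n x ^ 2 * lap φ x) atTop
      (nhds (∫ x, w x ^ 2 * lap φ x)) := by
    refine tendsto_integral_of_dominated_convergence (fun x => C ^ 2 * |lap φ x|)
      (fun n => (((hW n).continuous.pow 2).mul hφ.lap.continuous).aestronglyMeasurable)
      ((hφ.lap.continuous.integrable_of_hasCompactSupport hc.lap).abs.const_mul _)
      (fun n => .of_forall fun x => ?_) ?_
    · rw [Real.norm_eq_abs, abs_mul, abs_pow]
      gcongr
      exact hWC n x
    · filter_upwards [ae_tendsto_mollify_bumpKernel h.1] with x h1 using (h1.pow 2).mul_const _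
  exact le_of_tendsto_of_tendsto' (lim1.const_mul 2) lim2 hineq

/-! ### Locally bounded functions -/

theorem IsLocallyBounded.locallyIntegrable {g : Plane → ℝ} (hb : IsLocallyBounded g)
    (hm : AEStronglyMeasurable g volume) : LocallyIntegrable g volume := by
  rw [locallyIntegrable_iff]
  intro k hk
  obtain ⟨R, hR⟩ := hk.isBounded.subset_closedBall (0 : Plane)
  obtain ⟨M, hM⟩ := hb R
  refine Measure.integrableOn_of_bounded (M := M) hk.measure_lt_top.ne hm ?_
  filter_upwards [ae_restrict_mem hk.measurableSet] with x hx
  exact hM x (by simpa using hR hx)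

theorem Continuous.isLocallyBounded {g : Plane → ℝ} (hg : Continuous g) : IsLocallyBounded g := by
  intro R
  obtain ⟨C, hC⟩ := (isCompact_closedBall (0 : Plane) R).exists_bound_of_continuousOn
    hg.continuousOn
  exact ⟨C, fun x hx => hC x (by simpa using hx)⟩

theorem IsLocallyBounded.mul {f g : Plane → ℝ} (hf : IsLocallyBounded f)
    (hg : IsLocallyBounded g) : IsLocallyBounded (fun x => f x * g x) := by
  intro R
  obtain ⟨A, hA⟩ := hf R
  obtain ⟨B, hB⟩ := hg R
  refine ⟨A * B, fun x hx => ?_⟩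
  rw [abs_mul]
  exact mul_le_mul (hA x hx) (hB x hx) (abs_nonneg _) ((abs_nonneg _).trans (hA x hx))

theorem IsLocallyBounded.add {f g : Plane → ℝ} (hf : IsLocallyBounded f)
    (hg : IsLocallyBounded g) : IsLocallyBounded (fun x => f x + g x) := by
  intro R
  obtain ⟨A, hA⟩ := hf R
  obtain ⟨B, hB⟩ := hg R
  exact ⟨A + B, fun x hx => (abs_add_le _ _).trans (add_le_add (hA x hx) (hB x hx))⟩

theorem IsLocallyBounded.neg {f : Plane → ℝ} (hf : IsLocallyBounded f) :
    IsLocallyBounded (fun x => -f x) := by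
  intro R
  obtain ⟨A, hA⟩ := hf R
  exact ⟨A, fun x hx => by rw [abs_neg]; exact hA x hx⟩

/-! ### Testing with logarithmic cutoffs: total mass and Liouville -/

theorem tendsto_exp_natCast_add_one : Tendsto (fun n : ℕ => Real.exp (n + 1)) atTop atTop :=
  Real.tendsto_exp_atTop.comp (tendsto_atTop_add_const_right _ _ tendsto_natCast_atTop_atTop)

theorem lap_logCutoff_eq_zero {L : ℝ} (hL : 0 < L) {x : Plane} (hx : ‖x‖ < Real.exp L) :
    lap (logCutoff L) x = 0 :=
  lap_eq_zero_of_eventuallyEq_const (logCutoff_eventuallyEq_one hL hx)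

/-- The Laplacian of the cutoff vanishes inside radius e^L > R, so g matters only where it is
bounded. -/
theorem integrable_mul_lap_logCutoff {g : Plane → ℝ} {L C R : ℝ} (hL : 0 < L)
    (hRL : R < Real.exp L) (hg : AEStronglyMeasurable g volume)
    (hC : ∀ x, R < ‖x‖ → |g x| ≤ C) :
    Integrable (fun x => g x * lap (logCutoff L) x) ∧
      |∫ x, g x * lap (logCutoff L) x| ≤ C * ∫ x, |lap (logCutoff L) x| := by
  have hsm := contDiff_logCutoff hL
  have hcont := hsm.lap.continuous
  have hi : Integrable (fun x => C * |lap (logCutoff L) x|) :=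
    (hcont.integrable_of_hasCompactSupport
      (hasCompactSupport_logCutoff hL).lap).abs.const_mul C
  have hle : ∀ x, ‖g x * lap (logCutoff L) x‖ ≤ C * |lap (logCutoff L) x| := by
    intro x
    rw [Real.norm_eq_abs, abs_mul]
    rcases lt_or_ge ‖x‖ (Real.exp L) with h | h
    · rw [lap_logCutoff_eq_zero hL h]; simp
    · exact mul_le_mul_of_nonneg_right (hC x (hRL.trans_le h)) (abs_nonneg _)
  refine ⟨hi.mono' (hg.mul hcont.aestronglyMeasurable) (.of_forall hle), ?_⟩
  rw [← integral_const_mul]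
  exact norm_integral_le_of_norm_le hi (.of_forall hle)

/-- Functions bounded near infinity pair to zero with the Laplacians of the logarithmic cutoffs. -/
theorem tendsto_integral_mul_lap_logCutoff {g : Plane → ℝ} {C R : ℝ}
    (hg : AEStronglyMeasurable g volume) (hC : ∀ x, R < ‖x‖ → |g x| ≤ C) :
    Tendsto (fun n : ℕ => ∫ x, g x * lap (logCutoff (n + 1)) x) atTop (nhds 0) := by
  obtain ⟨M, hM0, hM⟩ := exists_integral_abs_lap_logCutoff_le
  have hC' : ∀ x, R < ‖x‖ → |g x| ≤ max C 0 := fun x hx => (hC x hx).trans (le_max_left _ _)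
  have hlim : Tendsto (fun n : ℕ => max C 0 * (M / ((n : ℝ) + 1))) atTop (nhds 0) := by
    have := (tendsto_const_div_atTop_nhds_zero_nat M).comp (tendsto_add_atTop_nat 1)
    simpa using this.const_mul (max C 0)
  refine squeeze_zero_norm' ?_ hlim
  filter_upwards [tendsto_exp_natCast_add_one.eventually_gt_atTop R] with n hn
  have hpos : (0 : ℝ) < n + 1 := by positivity
  exact (integrable_mul_lap_logCutoff hpos hn hg hC').2.trans
    (mul_le_mul_of_nonneg_left (hM _ hpos) (le_max_right _ _))

/-- The cutoffs are 1 on exhausting balls, so for g ≥ 0 the convergent sequence bounds the integrals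
over those balls. Once g is integrable it dominates its own cutoffs, which identifies the limit. -/
theorem integrable_of_tendsto_integral_mul_logCutoff {g : Plane → ℝ} {ℓ : ℝ}
    (hg : LocallyIntegrable g volume) (h0 : ∀ x, 0 ≤ g x)
    (hlim : Tendsto (fun n : ℕ => ∫ x, g x * logCutoff (n + 1) x) atTop (nhds ℓ)) :
    Integrable g volume ∧ ∫ x, g x = ℓ := by
  have hpos : ∀ n : ℕ, (0 : ℝ) < n + 1 := fun n => by positivity
  have hint : ∀ n : ℕ, Integrable (fun x => g x * logCutoff (n + 1) x) := fun n =>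
    LocallyIntegrable.integrable_mul_test hg (contDiff_logCutoff (hpos n)).continuous
      (hasCompactSupport_logCutoff (hpos n))
  obtain ⟨B, hB⟩ := hlim.bddAbove_range
  have hgi : Integrable g volume := by
    refine (aecover_closedBall (x := (0 : Plane))
      tendsto_exp_natCast_add_one).integrable_of_integral_bounded_of_nonneg_ae B
      (fun n => hg.integrableOn_isCompact (isCompact_closedBall _ _)) (.of_forall h0)
      (.of_forall fun n => ?_)
    refine le_trans ?_ (hB ⟨n, rfl⟩)
    calc ∫ x in Metric.closedBall 0 (Real.exp (n + 1)), g x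
        = ∫ x in Metric.closedBall 0 (Real.exp (n + 1)), g x * logCutoff (n + 1) x := by
          refine setIntegral_congr_fun Metric.isClosed_closedBall.measurableSet fun x hx => ?_
          rw [logCutoff_eq_one (hpos n) (by simpa using hx), mul_one]
      _ ≤ ∫ x, g x * logCutoff (n + 1) x :=
          setIntegral_le_integral (hint n)
            (.of_forall fun x => mul_nonneg (h0 x) (logCutoff_nonneg _ x))
  refine ⟨hgi, tendsto_nhds_unique ?_ hlim⟩
  refine tendsto_integral_of_dominated_convergence g (fun n => (hint n).aestronglyMeasurable) hgi
    (fun n => .of_forall fun x => ?_) (.of_forall fun x => ?_)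
  · rw [Real.norm_eq_abs, abs_mul, abs_of_nonneg (h0 x), abs_of_nonneg (logCutoff_nonneg _ x)]
    exact mul_le_of_le_one_right (h0 x) (logCutoff_le_one _ x)
  · refine tendsto_const_nhds.congr' ?_
    filter_upwards [tendsto_exp_natCast_add_one.eventually_ge_atTop ‖x‖] with n hn
    rw [logCutoff_eq_one (hpos n) hn, mul_one]

/-- A function with logarithmic growth `α log |x|` and nonnegative Laplacian `f` has total mass
`∫ f = 2πα`. -/
theorem WeakLap.integral_eq_of_log_growth {u f : Plane → ℝ} {α R C : ℝ} (h : WeakLap u f)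
    (hf : ∀ x, 0 ≤ f x) (hu : ∀ x, R < ‖x‖ → |u x - α * Real.log ‖x‖| ≤ C) :
    Integrable f volume ∧ ∫ x, f x = 2 * Real.pi * α := by
  refine integrable_of_tendsto_integral_mul_logCutoff h.2.1 hf ?_
  have hm : AEStronglyMeasurable (fun x => u x - α * Real.log ‖x‖) (volume : Measure Plane) :=
    h.1.aestronglyMeasurable.sub
      ((Real.measurable_log.comp measurable_norm).const_mul α).aestronglyMeasurable
  -- The bounded remainder contributes 0 in the limit; the part α log ‖x‖ contributes exactly 2πα
  -- for each cutoff.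
  have h1 := (tendsto_integral_mul_lap_logCutoff hm hu).add_const (2 * Real.pi * α)
  rw [zero_add] at h1
  refine h1.congr' ?_
  filter_upwards [tendsto_exp_natCast_add_one.eventually_gt_atTop R] with n hn
  have hpos : (0 : ℝ) < n + 1 := by positivity
  have hi := (integrable_mul_lap_logCutoff hpos hn hm hu).1
  have hsm := contDiff_logCutoff hpos
  have hcs := hasCompactSupport_logCutoff hpos
  have hi2 := LocallyIntegrable.integrable_mul_test h.1 hsm.lap.continuous hcs.lap
  rw [← h.2.2 _ hsm hcs, ← eq_sub_iff_add_eq', ← integral_sub hi2 hi,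
    ← integral_log_mul_lap_logCutoff hpos, mul_comm, ← integral_const_mul]
  refine integral_congr_ae (.of_forall fun x => ?_)
  simp only
  ring

/-- If `w` is bounded and `w Δw ≥ 0` then `w Δw = 0`. -/
theorem WeakLap.mul_ae_eq_zero {w F : Plane → ℝ} {C : ℝ} (h : WeakLap w F)
    (hw : ∀ x, |w x| ≤ C) (hF : IsLocallyBounded F) (h0 : ∀ x, 0 ≤ w x * F x) :
    ∀ᵐ x, w x * F x = 0 := by
  have hwb : IsLocallyBounded w := fun _ => ⟨C, fun x _ => hw x⟩
  have hli : LocallyIntegrable (fun x => w x * F x) volume :=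
    (hwb.mul hF).locallyIntegrable (h.1.aestronglyMeasurable.mul h.2.1.aestronglyMeasurable)
  have hC : ∀ x, (0 : ℝ) < ‖x‖ → |w x ^ 2| ≤ C ^ 2 := fun x _ => by
    rw [abs_pow]; gcongr; exact hw x
  have hlim : Tendsto (fun n : ℕ => ∫ x, w x * F x * logCutoff (n + 1) x) atTop (nhds 0) := by
    have h1 := tendsto_integral_mul_lap_logCutoff (h.1.aestronglyMeasurable.pow 2) hC
    -- With η the cutoff, 0 ≤ ∫ w F η ≤ ½ ∫ w² Δη, and w² is bounded.
    refine squeeze_zero (fun n => integral_nonneg fun x => mul_nonneg (h0 x) (logCutoff_nonneg _ x))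
      (fun n => ?_) (by simpa using h1.div_const 2)
    have hpos : (0 : ℝ) < n + 1 := by positivity
    have h2 := h.two_mul_integral_le hw hF (contDiff_logCutoff hpos)
      (hasCompactSupport_logCutoff hpos) (logCutoff_nonneg _)
    simp only [mul_comm (logCutoff _ _)] at h2
    linarith
  obtain ⟨hi, hz⟩ := integrable_of_tendsto_integral_mul_logCutoff hli h0 hlim
  exact (integral_eq_zero_iff_of_nonneg h0 hi).1 hz

/-- Liouville's theorem for bounded smooth harmonic functions on the plane. -/
theorem eq_of_bounded_of_lap_eq_zero {h : Plane → ℝ} {C : ℝ} (hh : ContDiff ℝ ∞ h)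
    (hb : ∀ x, |h x| ≤ C) (hl : ∀ x, lap h x = 0) (x y : Plane) : h x = h y := by
  have hsq : ContDiff ℝ ∞ (fun x => h x ^ 2) := hh.pow 2
  have hform : ∀ x, lap (fun y => h y ^ 2) x = 2 * ∑ i, (fderiv ℝ h x (stdVec i)) ^ 2 := fun x => by
    rw [lap_sq hh, hl]; ring
  have hnn : ∀ x, 0 ≤ lap (fun y => h y ^ 2) x := fun x => by rw [hform]; positivity
  have hC : ∀ x, (0 : ℝ) < ‖x‖ → |h x ^ 2| ≤ C ^ 2 := fun x _ => by
    rw [abs_pow]; gcongr; exact hb x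
  have hlim := tendsto_integral_mul_lap_logCutoff (hsq.continuous.aestronglyMeasurable) hC
  -- Here Δ(h²) = 2|∇h|², so this limit says that the Dirichlet energy is zero.
  have hlim2 : Tendsto (fun n : ℕ => ∫ x, lap (fun y => h y ^ 2) x * logCutoff (n + 1) x) atTop
      (nhds 0) := by
    refine hlim.congr fun n => ?_
    have hpos : (0 : ℝ) < n + 1 := by positivity
    exact integral_mul_lap hsq (contDiff_logCutoff hpos) (hasCompactSupport_logCutoff hpos)
  obtain ⟨hi, hz⟩ := integrable_of_tendsto_integral_mul_logCutoff
    hsq.lap.continuous.locallyIntegrable hnn hlim2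
  have hz2 := (integral_eq_zero_iff_of_nonneg hnn hi).1 hz
  have hz3 := (Continuous.ae_eq_iff_eq volume hsq.lap.continuous continuous_zero).1 hz2
  refine is_const_of_fderiv_eq_zero (𝕜 := ℝ) (hh.differentiable (by simp)) (fun z => ?_) x y
  have h1 := congrFun hz3 z
  rw [hform] at h1
  have h2 : ∑ i, (fderiv ℝ h z (stdVec i)) ^ 2 = 0 := by simpa using h1
  rw [Finset.sum_eq_zero_iff_of_nonneg fun i _ => sq_nonneg _] at h2
  refine ContinuousLinearMap.coe_injective
    ((EuclideanSpace.basisFun (Fin 2) ℝ).toBasis.ext fun i => ?_)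
  simpa using h2 i (Finset.mem_univ i)

/-- Mollifications of w are smooth, harmonic and bounded by C, hence constant; continuity of w
recovers its values as their pointwise limit. -/
theorem WeakLap.eq_of_bounded_of_ae_eq_zero {w F : Plane → ℝ} {C : ℝ} (h : WeakLap w F)
    (hwc : Continuous w) (hw : ∀ x, |w x| ≤ C) (hF : F =ᵐ[volume] 0) (x y : Plane) : w x = w y := by
  have h' := h.congr_ae .rfl hF
  have hconst : ∀ n, mollify (bumpKernel n) w x = mollify (bumpKernel n) w y := fun n => by
    refine eq_of_bounded_of_lap_eq_zero
      (contDiff_mollify (contDiff_bumpKernel n) (hasCompactSupport_bumpKernel n) h.1)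
      (C := C) (fun z => abs_mollify_bumpKernel_le fun y _ => hw y) (fun z => ?_) x y
    rw [h'.lap_mollify (contDiff_bumpKernel n) (hasCompactSupport_bumpKernel n)]
    simp [mollify]
  exact tendsto_nhds_unique (tendsto_mollify_bumpKernel hwc x)
    ((tendsto_mollify_bumpKernel hwc y).congr fun n => (hconst n).symm)

/-! ### Total curvature and uniqueness -/

theorem isBigO_cocompact_one_iff {g : Plane → ℝ} :
    g =O[cocompact Plane] (fun _ => (1 : ℝ)) ↔ ∃ R C : ℝ, ∀ x, R < ‖x‖ → |g x| ≤ C := by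
  rw [← Metric.cobounded_eq_cocompact, isBigO_iff]
  constructor
  · rintro ⟨C, hC⟩
    obtain ⟨R, -, hR⟩ := hasBasis_cobounded_norm.eventually_iff.1 hC
    exact ⟨R, C, fun x hx => by simpa using hR hx.le⟩
  · rintro ⟨R, C, hC⟩
    exact ⟨C, hasBasis_cobounded_norm.eventually_iff.2 ⟨R + 1, trivial, fun x hx => by
      simpa using hC x (lt_of_lt_of_le (lt_add_one R) hx)⟩⟩

theorem IsLogGrowthSolution.integrable_and_integral_eq {K : Plane → ℝ} {α : ℝ} {u : Plane → ℝ}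
    (hu : IsLogGrowthSolution K α u) (hK : ∀ x, K x ≤ 0) :
    Integrable (fun x => K x * Real.exp (2 * u x)) volume ∧
      ∫ x, K x * Real.exp (2 * u x) = -2 * α * Real.pi := by
  obtain ⟨R, C, hC⟩ := isBigO_cocompact_one_iff.1 hu.2.2
  have h := (solvesPoisson_iff_weakLap.1 hu.2.1).integral_eq_of_log_growth
    (fun x => neg_nonneg.2 (mul_nonpos_of_nonpos_of_nonneg (hK x) (Real.exp_pos _).le)) hC
  refine ⟨by simpa [Function.comp_def] using h.1.neg, ?_⟩
  have h2 := h.2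
  rw [integral_neg] at h2
  linarith

theorem IsLogGrowthSolution.unique {K : Plane → ℝ} {α : ℝ} {u₁ u₂ : Plane → ℝ}
    (h₁ : IsLogGrowthSolution K α u₁) (h₂ : IsLogGrowthSolution K α u₂) (hK : ∀ x, K x ≤ 0)
    (hKb : IsLocallyBounded K) (hα : 0 < α) : u₁ = u₂ := by
  set w := fun x => u₁ x - u₂ x
  have hwc : Continuous w := h₁.1.sub h₂.1
  have hw := (solvesPoisson_iff_weakLap.1 h₁.2.1).sub (solvesPoisson_iff_weakLap.1 h₂.2.1)
  set F : Plane → ℝ := fun x => -(K x * Real.exp (2 * u₁ x)) - -(K x * Real.exp (2 * u₂ x))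
  have hFeq : ∀ x, F x = -K x * (Real.exp (2 * u₁ x) - Real.exp (2 * u₂ x)) := fun x => by
    simp only [F]; ring
  have hFb : IsLocallyBounded F := by
    have c1 : Continuous fun x => Real.exp (2 * u₁ x) - Real.exp (2 * u₂ x) := by
      have := h₁.1; have := h₂.1; fun_prop
    simpa only [← hFeq] using hKb.neg.mul c1.isLocallyBounded
  obtain ⟨C, hC⟩ : ∃ C, ∀ x, |w x| ≤ C := by
    have hO : w =O[cocompact Plane] fun _ => (1 : ℝ) := by
      refine (h₁.2.2.sub h₂.2.2).congr_left fun x => ?_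
      simp only [w]; ring
    obtain ⟨R, C, hC⟩ := isBigO_cocompact_one_iff.1 hO
    obtain ⟨C', hC'⟩ := hwc.isLocallyBounded R
    refine ⟨max C C', fun x => ?_⟩
    rcases lt_or_ge R ‖x‖ with h | h
    · exact (hC x h).trans (le_max_left _ _)
    · exact (hC' x h).trans (le_max_right _ _)
  -- exp is increasing and −K ≥ 0, so w and Δw never have opposite signs.
  have hsign : ∀ x, 0 ≤ w x * F x := by
    intro x
    rw [hFeq]
    have hk := neg_nonneg.2 (hK x)
    rcases le_total (u₁ x) (u₂ x) with h | h
    · have h1 : Real.exp (2 * u₁ x) ≤ Real.exp (2 * u₂ x) := Real.exp_le_exp.2 (by linarith)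
      exact mul_nonneg_of_nonpos_of_nonpos (by simp only [w]; linarith)
        (mul_nonpos_of_nonneg_of_nonpos hk (by linarith))
    · have h1 : Real.exp (2 * u₂ x) ≤ Real.exp (2 * u₁ x) := Real.exp_le_exp.2 (by linarith)
      exact mul_nonneg (by simp only [w]; linarith) (mul_nonneg hk (by linarith))
  have hF0 : F =ᵐ[volume] 0 := by
    filter_upwards [hw.mul_ae_eq_zero hC hFb hsign] with x hx
    rcases mul_eq_zero.1 hx with h | h
    · rw [hFeq, sub_eq_zero.1 h]; simp
    · exact h
  have hconst := hw.eq_of_bounded_of_ae_eq_zero hwc hC hF0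
  -- The equation alone does not exclude solutions differing by a constant (K = 0); the total
  -- curvature does, through α > 0.
  by_cases hzero : w 0 = 0
  · ext x
    exact sub_eq_zero.1 ((hconst x 0).trans hzero)
  exfalso
  have hK0 : (fun x => K x * Real.exp (2 * u₁ x)) =ᵐ[volume] 0 := by
    filter_upwards [hF0] with x hx
    rw [hFeq] at hx
    rcases mul_eq_zero.1 hx with h | h
    · simp [neg_eq_zero.1 h]
    · have h3 := Real.exp_injective (sub_eq_zero.1 h)
      exact absurd ((hconst 0 x).trans (sub_eq_zero.2 (by linarith))) hzero
  have := (h₁.integrable_and_integral_eq hK).2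
  rw [integral_congr_ae hK0] at this
  simp only [Pi.zero_apply, integral_zero] at this
  nlinarith [Real.pi_pos, mul_pos hα Real.pi_pos]

/-! ### Regularization by dilates of a smoothed logarithm -/

theorem lap_eq_zero_of_eq_log {w : Plane → ℝ} (hlog : ∀ x : Plane, 1 ≤ ‖x‖ → w x = Real.log ‖x‖)
    {x : Plane} (hx : 1 < ‖x‖) : lap w x = 0 := by
  have h0 : w =ᶠ[nhds x] fun y => (fun s => Real.log s / 2) (‖y‖ ^ 2) := by
    filter_upwards [continuous_norm.continuousAt.eventually (Ioi_mem_nhds hx)] with y hy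
    rw [hlog y (le_of_lt hy), Real.log_pow]
    push_cast; ring
  have hs : 0 < ‖x‖ ^ 2 := by positivity
  have h1 : lap w x = _ := (InnerProductSpace.laplacian_congr_nhds h0).eq_of_nhds
  have hcd : ContDiffAt ℝ 2 (fun s => Real.log s / 2) (‖x‖ ^ 2) :=
    (Real.contDiffAt_log.2 hs.ne').div_const _
  have hd : deriv (fun s => Real.log s / 2) = fun s => s⁻¹ / 2 := by
    ext s
    rw [deriv_div_const, Real.deriv_log]
  rw [h1]
  change lap _ x = 0
  rw [lap_radial hcd, hd, deriv_div_const, deriv_inv]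
  field_simp
  ring

/-- Apply Green's identity with the cutoff for L = 1: it is 1 wherever the Laplacian of w can be
nonzero, and w is the logarithm wherever the Laplacian of the cutoff can be nonzero. -/
theorem integral_lap_eq_two_pi {w : Plane → ℝ} (hw : ContDiff ℝ ∞ w)
    (hlog : ∀ x : Plane, 1 ≤ ‖x‖ → w x = Real.log ‖x‖) : ∫ x, lap w x = 2 * Real.pi := by
  have hpos : (0 : ℝ) < 1 := one_pos
  have he : 1 < Real.exp 1 := Real.one_lt_exp_iff.2 one_pos
  have h1 := integral_mul_lap hw (contDiff_logCutoff hpos) (hasCompactSupport_logCutoff hpos)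
  rw [← integral_log_mul_lap_logCutoff hpos]
  have h2 : ∀ x, w x * lap (logCutoff 1) x = Real.log ‖x‖ * lap (logCutoff 1) x := fun x => by
    rcases lt_or_ge ‖x‖ (Real.exp 1) with h | h
    · rw [lap_logCutoff_eq_zero hpos h]; simp
    · rw [hlog x (he.le.trans h)]
  have h3 : ∀ x, lap w x * logCutoff 1 x = lap w x := fun x => by
    rcases le_or_gt ‖x‖ (Real.exp 1) with h | h
    · rw [logCutoff_eq_one hpos h, mul_one]
    · rw [lap_eq_zero_of_eq_log hlog (he.trans h), zero_mul]
  simpa only [h2, h3] using h1.symm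

/-- The Laplacian, rescaled to unit mass, of a smooth function equal to `log ‖x‖` outside the unit
ball, dilated to scale `2⁻ᵏ`. -/
noncomputable def logKernel (w : Plane → ℝ) (k : ℕ) (x : Plane) : ℝ :=
  (2 * Real.pi)⁻¹ * (((2 : ℝ) ^ k) ^ 2 * lap w ((2 : ℝ) ^ k • x))

/-- The difference of the dilates at scales `2⁻ᵏ` and `2⁻ᵏ⁻¹` of a smooth function equal to
`log ‖x‖` outside the unit ball. -/
noncomputable def logPotential (w : Plane → ℝ) (k : ℕ) (x : Plane) : ℝ :=
  (2 * Real.pi)⁻¹ * (w ((2 : ℝ) ^ k • x) - w ((2 : ℝ) ^ (k + 1) • x) + Real.log 2)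

section LogKernel

variable {w : Plane → ℝ}

theorem contDiff_logKernel (hw : ContDiff ℝ ∞ w) (k : ℕ) : ContDiff ℝ ∞ (logKernel w k) :=
  contDiff_const.mul (contDiff_const.mul (hw.lap.comp (contDiff_const_smul _)))

theorem contDiff_logPotential (hw : ContDiff ℝ ∞ w) (k : ℕ) :
    ContDiff ℝ ∞ (logPotential w k) := by
  unfold logPotential
  fun_prop

theorem logKernel_eq_zero (hlog : ∀ x : Plane, 1 ≤ ‖x‖ → w x = Real.log ‖x‖) {k : ℕ} {x : Plane}
    (hx : ((2 : ℝ) ^ k)⁻¹ < ‖x‖) : logKernel w k x = 0 := by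
  have h2 : (0 : ℝ) < 2 ^ k := by positivity
  have : 1 < ‖(2 : ℝ) ^ k • x‖ := by
    rw [norm_smul, Real.norm_of_nonneg h2.le]
    rwa [inv_lt_iff_one_lt_mul₀ h2, mul_comm] at hx
  rw [logKernel, lap_eq_zero_of_eq_log hlog this]
  simp

/-- The constant log 2 in `logPotential` compensates the difference of the logarithms of the two
dilation factors. -/
theorem logPotential_eq_zero (hlog : ∀ x : Plane, 1 ≤ ‖x‖ → w x = Real.log ‖x‖) {k : ℕ}
    {x : Plane} (hx : 1 < ‖x‖) : logPotential w k x = 0 := by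
  have key : ∀ j : ℕ, w ((2 : ℝ) ^ j • x) = j * Real.log 2 + Real.log ‖x‖ := by
    intro j
    have h2 : (1 : ℝ) ≤ 2 ^ j := one_le_pow₀ (by norm_num)
    have hn : ‖(2 : ℝ) ^ j • x‖ = 2 ^ j * ‖x‖ := by
      rw [norm_smul, Real.norm_of_nonneg (by positivity)]
    rw [hlog _ (by rw [hn]; nlinarith), hn, Real.log_mul (by positivity) (by linarith),
      Real.log_pow]
  rw [logPotential, key, key]
  push_cast
  ring

theorem hasCompactSupport_of_eq_zero {f : Plane → ℝ} {r : ℝ} (h : ∀ x, r < ‖x‖ → f x = 0) :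
    HasCompactSupport f :=
  HasCompactSupport.intro (isCompact_closedBall (0 : Plane) r) fun z hz => h z (by simpa using hz)

theorem inv_two_pow_le_one (k : ℕ) : ((2 : ℝ) ^ k)⁻¹ ≤ 1 :=
  inv_le_one_of_one_le₀ (one_le_pow₀ (by norm_num))

theorem hasCompactSupport_logKernel (hlog : ∀ x : Plane, 1 ≤ ‖x‖ → w x = Real.log ‖x‖) (k : ℕ) :
    HasCompactSupport (logKernel w k) :=
  hasCompactSupport_of_eq_zero fun _ hx => logKernel_eq_zero hlog hx

theorem hasCompactSupport_logPotential (hlog : ∀ x : Plane, 1 ≤ ‖x‖ → w x = Real.log ‖x‖)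
    (k : ℕ) : HasCompactSupport (logPotential w k) :=
  hasCompactSupport_of_eq_zero fun _ hx => logPotential_eq_zero hlog hx

/-- This makes consecutive regularizations of u differ by an average of Δu alone, which is how
bounds on f control u. -/
theorem lap_logPotential (hw : ContDiff ℝ ∞ w) (k : ℕ) (x : Plane) :
    lap (logPotential w k) x = logKernel w k x - logKernel w (k + 1) x := by
  have hs : ∀ j : ℕ, ContDiff ℝ ∞ fun y : Plane => w ((2 : ℝ) ^ j • y) := fun j => by fun_prop
  have hl : ∀ j : ℕ, lap (fun y : Plane => w ((2 : ℝ) ^ j • y)) x =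
      ((2 : ℝ) ^ j) ^ 2 * lap w ((2 : ℝ) ^ j • x) := fun j => by
    simpa using lap_comp_affine hw 0 ((2 : ℝ) ^ j) x
  have h1 : logPotential w k = (2 * Real.pi)⁻¹ • (((fun y : Plane => w ((2 : ℝ) ^ k • y)) -
      fun y : Plane => w ((2 : ℝ) ^ (k + 1) • y)) + fun _ => Real.log 2) := rfl
  have c1 := (hs k).two_of_smooth.contDiffAt (x := x)
  have c2 := (hs (k + 1)).two_of_smooth.contDiffAt (x := x)
  have c3 : ContDiffAt ℝ 2 (fun _ : Plane => Real.log 2) x := contDiffAt_const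
  have h2 : lap (logPotential w k) x = (2 * Real.pi)⁻¹ *
      (lap (fun y : Plane => w ((2 : ℝ) ^ k • y)) x -
        lap (fun y : Plane => w ((2 : ℝ) ^ (k + 1) • y)) x) := by
    have c12 : ContDiffAt ℝ 2 ((fun y : Plane => w ((2 : ℝ) ^ k • y)) -
      fun y : Plane => w ((2 : ℝ) ^ (k + 1) • y)) x := c1.sub c2
    have c123 : ContDiffAt ℝ 2 (((fun y : Plane => w ((2 : ℝ) ^ k • y)) -
      fun y : Plane => w ((2 : ℝ) ^ (k + 1) • y)) + fun _ => Real.log 2) x := c12.add c3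
    rw [h1]
    unfold lap
    rw [InnerProductSpace.laplacian_smul _ c123, c12.laplacian_add c3, c1.laplacian_sub c2]
    simp
  rw [h2, hl, hl, logKernel, logKernel]
  ring

/-- The k-th potential is the 0-th one precomposed with x ↦ 2^k x, and areas scale by 4^{-k}. This
is the geometric convergence rate. -/
theorem integral_abs_logPotential (k : ℕ) :
    ∫ x, |logPotential w k x| = ((4 : ℝ) ^ k)⁻¹ * ∫ x, |logPotential w 0 x| := by
  have h := Measure.integral_comp_smul (volume : Measure Plane) (fun x => |logPotential w 0 x|)
    ((2 : ℝ) ^ k)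
  have h2 : ∀ x, logPotential w 0 ((2 : ℝ) ^ k • x) = logPotential w k x := fun x => by
    simp only [logPotential, smul_smul]
    congr 4 <;> ring_nf
  simp only [h2] at h
  rw [h]
  have h4 : ((2 : ℝ) ^ k) ^ 2 = 4 ^ k := by rw [← pow_mul, mul_comm, pow_mul]; norm_num
  simp [h4]

theorem integral_logKernel (hw : ContDiff ℝ ∞ w)
    (hlog : ∀ x : Plane, 1 ≤ ‖x‖ → w x = Real.log ‖x‖) (k : ℕ) : ∫ x, logKernel w k x = 1 := by
  have h := Measure.integral_comp_smul (volume : Measure Plane) (lap w) ((2 : ℝ) ^ k)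
  unfold logKernel
  rw [integral_const_mul, integral_const_mul, h, integral_lap_eq_two_pi hw hlog]
  have : (0 : ℝ) < 2 ^ k := by positivity
  simp
  field_simp

/-- Convergence at Lebesgue points: the kernels have integral one, live in balls of radius 2^{-k},
and are bounded by a constant over the area of those balls. No sign of the kernel is needed. -/
theorem ae_tendsto_mollify_logKernel (hw : ContDiff ℝ ∞ w)
    (hlog : ∀ x : Plane, 1 ≤ ‖x‖ → w x = Real.log ‖x‖) {u : Plane → ℝ}
    (hu : LocallyIntegrable u volume) :
    ∀ᵐ x, Tendsto (fun k => mollify (logKernel w k) u x) atTop (nhds (u x)) := by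
  obtain ⟨M, hM⟩ := (hasCompactSupport_of_eq_zero
    fun _ hx => lap_eq_zero_of_eq_log hlog hx).exists_bound_of_continuous hw.lap.continuous
  filter_upwards [(Besicovitch.vitaliFamily volume).ae_tendsto_average_norm_sub hu] with x hx
  have hr : Tendsto (fun k : ℕ => ((2 : ℝ) ^ k)⁻¹) atTop (nhdsWithin 0 (Set.Ioi 0)) :=
    tendsto_nhdsWithin_iff.2 ⟨tendsto_inv_atTop_zero.comp
      (tendsto_pow_atTop_atTop_of_one_lt (by norm_num)),
      .of_forall fun k => by simp only [Set.mem_Ioi]; positivity⟩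
  have h1 := (hx.comp (Besicovitch.tendsto_filterAt volume x)).comp hr
  have h2 := tendsto_integral_smul_of_tendsto_average_norm_sub
    (g := fun k y => logKernel w k (x - y)) ((2 * Real.pi)⁻¹ * M * Real.pi) h1
    (.of_forall fun k => hu.integrableOn_isCompact (isCompact_closedBall _ _))
    (tendsto_const_nhds.congr fun k => ?_) (.of_forall fun k => ?_) (.of_forall fun k y => ?_)
  · refine h2.congr fun k => ?_
    simp only [smul_eq_mul, mul_comm, mollify]
  · rw [integral_sub_left_eq_self (logKernel w k) volume x, integral_logKernel hw hlog]
  · intro y hy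
    by_contra h
    refine hy (logKernel_eq_zero hlog ?_)
    simpa [dist_eq_norm, norm_sub_rev] using h
  · have hv : (volume : Measure Plane).real (Metric.closedBall x ((2 : ℝ) ^ k)⁻¹) =
        Real.pi / ((2 : ℝ) ^ k) ^ 2 := by
      rw [measureReal_def, EuclideanSpace.volume_closedBall_fin_two]
      simp [Real.pi_pos.le]
      field_simp
    rw [hv, logKernel, abs_mul, abs_mul, abs_of_pos (by positivity : (0 : ℝ) < (2 * Real.pi)⁻¹),
      abs_of_pos (by positivity : (0 : ℝ) < ((2 : ℝ) ^ k) ^ 2)]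
    calc (2 * Real.pi)⁻¹ * (((2 : ℝ) ^ k) ^ 2 * |lap w ((2 : ℝ) ^ k • (x - y))|)
        ≤ (2 * Real.pi)⁻¹ * (((2 : ℝ) ^ k) ^ 2 * M) := by gcongr; exact hM _
      _ = _ := by field_simp

/-- A weak solution of `Δ u = f` with `f` locally bounded has a continuous representative, which its
regularizations approach at a rate depending only on the local bounds of `f`. -/
theorem WeakLap.exists_continuous_representative (hw : ContDiff ℝ ∞ w)
    (hlog : ∀ x : Plane, 1 ≤ ‖x‖ → w x = Real.log ‖x‖) {u f : Plane → ℝ} (h : WeakLap u f)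
    (hf : IsLocallyBounded f) :
    ∃ u' : Plane → ℝ, Continuous u' ∧ u =ᵐ[volume] u' ∧
      ∀ (k : ℕ) (x : Plane) (M : ℝ), (∀ y, ‖y - x‖ ≤ 1 → |f y| ≤ M) →
        |mollify (logKernel w k) u x - u' x| ≤
          2 * M * (∫ z, |logPotential w 0 z|) * ((4 : ℝ) ^ k)⁻¹ := by
  set A := ∫ z, |logPotential w 0 z|
  have hA : 0 ≤ A := integral_nonneg fun _ => abs_nonneg _
  set U := fun k => mollify (logKernel w k) u
  have hstep : ∀ (x : Plane) (M : ℝ), (∀ y, ‖y - x‖ ≤ 1 → |f y| ≤ M) → ∀ k : ℕ,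
      dist (U k x) (U (k + 1) x) ≤ M * A * (1 / 4 : ℝ) ^ k := by
    intro x M hM k
    have hI : ∀ j, Integrable fun y => u y * logKernel w j (x - y) := fun j =>
      LocallyIntegrable.integrable_mul_test h.1
        ((contDiff_logKernel hw j).continuous.comp (continuous_const.sub continuous_id))
        ((hasCompactSupport_logKernel hlog j).comp_homeomorph (Homeomorph.subLeft x))
    -- The kernel difference is a Laplacian, which the weak equation moves onto u.
    have h1 : U k x - U (k + 1) x = mollify (logPotential w k) f x := by
      rw [← h.mollify_lap (contDiff_logPotential hw k) (hasCompactSupport_logPotential hlog k)]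
      simp only [U, mollify, lap_logPotential hw, mul_sub]
      rw [integral_sub (hI _) (hI _)]
    rw [Real.dist_eq, h1]
    refine (abs_mollify_le (contDiff_logPotential hw k).continuous
      (fun z hz => logPotential_eq_zero hlog hz) hM).trans (le_of_eq ?_)
    rw [integral_abs_logPotential, one_div, inv_pow]
    ring
  have hloc : ∀ x : Plane, ∃ M, ∀ x', ‖x' - x‖ < 1 → ∀ y, ‖y - x'‖ ≤ 1 → |f y| ≤ M := by
    intro x
    obtain ⟨M, hM⟩ := hf (‖x‖ + 2)
    refine ⟨M, fun x' hx' y hy => hM y ?_⟩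
    have : y = x + (x' - x) + (y - x') := by abel
    calc ‖y‖ = ‖x + (x' - x) + (y - x')‖ := by rw [← this]
      _ ≤ ‖x‖ + ‖x' - x‖ + ‖y - x'‖ := norm_add₃_le
      _ ≤ ‖x‖ + 2 := by linarith
  have hlim : ∀ x, ∃ a, Tendsto (fun k => U k x) atTop (nhds a) := by
    intro x
    obtain ⟨M, hM⟩ := hloc x
    exact cauchySeq_tendsto_of_complete
      (cauchySeq_of_le_geometric (1 / 4) (M * A) (by norm_num) (hstep x M (hM x (by simp))))
  choose u' hu' using hlim
  have hrate : ∀ (k : ℕ) (x : Plane) (M : ℝ), (∀ y, ‖y - x‖ ≤ 1 → |f y| ≤ M) →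
      |U k x - u' x| ≤ 2 * M * A * ((4 : ℝ) ^ k)⁻¹ := by
    intro k x M hM
    have h1 := dist_le_of_le_geometric_of_tendsto (1 / 4) (M * A) (by norm_num) (hstep x M hM)
      (hu' x) k
    have hM0 : 0 ≤ M := (abs_nonneg _).trans (hM x (by simp))
    rw [Real.dist_eq] at h1
    refine h1.trans ?_
    rw [one_div, inv_pow]
    have : 0 ≤ M * A * ((4 : ℝ) ^ k)⁻¹ := by positivity
    rw [div_le_iff₀ (by norm_num)]
    linarith
  have hUc : ∀ k, Continuous (U k) := fun k =>
    (contDiff_mollify (contDiff_logKernel hw k) (hasCompactSupport_logKernel hlog k) h.1).continuous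
  refine ⟨u', ?_, ?_, hrate⟩
  · rw [continuous_iff_continuousAt]
    intro x
    obtain ⟨M, hM⟩ := hloc x
    have hzero : Tendsto (fun k : ℕ => 2 * M * A * ((4 : ℝ) ^ k)⁻¹) atTop (nhds 0) := by
      have : Tendsto (fun k : ℕ => ((4 : ℝ) ^ k)⁻¹) atTop (nhds 0) :=
        tendsto_inv_atTop_zero.comp (tendsto_pow_atTop_atTop_of_one_lt (by norm_num))
      simpa using this.const_mul (2 * M * A)
    -- One bound on f serves a whole unit ball around x, so the rate is uniform there and continuity
    -- passes to the limit.
    have hunif : TendstoUniformlyOn U u' atTop (Metric.ball x 1) := by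
      rw [Metric.tendstoUniformlyOn_iff]
      intro ε hε
      filter_upwards [hzero.eventually_lt_const hε] with k hk y hy
      rw [dist_comm, Real.dist_eq]
      exact (hrate k y M (hM y (by simpa [dist_eq_norm] using hy))).trans_lt hk
    exact (hunif.continuousOn (.of_forall fun k => (hUc k).continuousOn)).continuousAt
      (Metric.ball_mem_nhds x one_pos)
  · filter_upwards [ae_tendsto_mollify_logKernel hw hlog h.1] with x hx
    exact tendsto_nhds_unique hx (hu' x)

/-- Uniformly bounded weak solutions with locally uniformly bounded Laplacians are
equicontinuous. -/
theorem equicontinuous_of_weakLap (hw : ContDiff ℝ ∞ w)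
    (hlog : ∀ x : Plane, 1 ≤ ‖x‖ → w x = Real.log ‖x‖) {ι : Type*} {Y F : ι → Plane → ℝ} {c : ℝ}
    (h : ∀ n, WeakLap (Y n) (F n)) (hY : ∀ n, Continuous (Y n)) (hc : ∀ n x, |Y n x| ≤ c)
    (hF : ∀ R : ℝ, ∃ M, ∀ n x, ‖x‖ ≤ R → |F n x| ≤ M) : Equicontinuous Y := by
  have happ : ∀ n (k : ℕ) (x : Plane) (M : ℝ), (∀ y, ‖y - x‖ ≤ 1 → |F n y| ≤ M) →
      |mollify (logKernel w k) (Y n) x - Y n x| ≤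
        2 * M * (∫ z, |logPotential w 0 z|) * ((4 : ℝ) ^ k)⁻¹ := by
    intro n
    have hFn : IsLocallyBounded (F n) := fun R => by
      obtain ⟨M, hM⟩ := hF R
      exact ⟨M, hM n⟩
    obtain ⟨u', hu', hae, hrate⟩ := (h n).exists_continuous_representative hw hlog hFn
    -- Continuous functions equal a.e. coincide, so the rate holds for Y n itself.
    obtain rfl := (Continuous.ae_eq_iff_eq volume (hY n) hu').1 hae
    exact hrate
  set A := ∫ z, |logPotential w 0 z|
  intro x
  rw [Metric.equicontinuousAt_iff]
  intro ε hε
  obtain ⟨M, hM⟩ := hF (‖x‖ + 2)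
  have hM' : ∀ n x', ‖x' - x‖ ≤ 1 → ∀ y, ‖y - x'‖ ≤ 1 → |F n y| ≤ M := by
    intro n x' hx' y hy
    refine hM n y ?_
    have : y = x + (x' - x) + (y - x') := by abel
    calc ‖y‖ = ‖x + (x' - x) + (y - x')‖ := by rw [← this]
      _ ≤ ‖x‖ + ‖x' - x‖ + ‖y - x'‖ := norm_add₃_le
      _ ≤ ‖x‖ + 2 := by linarith
  have hzero : Tendsto (fun k : ℕ => 2 * M * A * ((4 : ℝ) ^ k)⁻¹) atTop (nhds 0) := by
    have : Tendsto (fun k : ℕ => ((4 : ℝ) ^ k)⁻¹) atTop (nhds 0) :=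
      tendsto_inv_atTop_zero.comp (tendsto_pow_atTop_atTop_of_one_lt (by norm_num))
    simpa using this.const_mul (2 * M * A)
  -- An ε/3 argument: the scale k is fixed first, uniformly in n; the regularizations at that scale
  -- are equicontinuous because the Y n are uniformly bounded and the kernel is uniformly
  -- continuous.
  obtain ⟨k, hk⟩ := (hzero.eventually_lt_const (show 0 < ε / 3 by positivity)).exists
  have hkc := (contDiff_logKernel hw k).continuous
  have hks := hasCompactSupport_logKernel hlog k
  set V := (volume : Measure Plane).real (Metric.closedBall x 2)
  have hV : 0 ≤ V := measureReal_nonneg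
  set η := ε / 3 / (|c| * V + 1)
  have hη : 0 < η := by positivity
  obtain ⟨δ, hδ, hδ'⟩ := Metric.uniformContinuous_iff.1
    (hks.uniformContinuous_of_continuous hkc) η hη
  refine ⟨min δ 1, by positivity, fun x' hx' n => ?_⟩
  have hx1 : ‖x' - x‖ ≤ 1 := by
    rw [← dist_eq_norm]; exact (hx'.trans_le (min_le_right _ _)).le
  have hx2 : dist x' x < δ := hx'.trans_le (min_le_left _ _)
  have hmid : |mollify (logKernel w k) (Y n) x - mollify (logKernel w k) (Y n) x'| < ε / 3 := by
    have hI : ∀ z, Integrable fun y => Y n y * logKernel w k (z - y) := fun z =>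
      LocallyIntegrable.integrable_mul_test (h n).1 (hkc.comp (continuous_const.sub continuous_id))
        (hks.comp_homeomorph (Homeomorph.subLeft z))
    -- Radius 2 suffices: kernel radius at most 1, plus ‖x' − x‖ ≤ 1.
    rw [mollify, mollify, ← integral_sub (hI x) (hI x'),
      ← setIntegral_eq_integral_of_forall_compl_eq_zero (s := Metric.closedBall x 2)]
    · have hb : ‖∫ y in Metric.closedBall x 2,
          (Y n y * logKernel w k (x - y) - Y n y * logKernel w k (x' - y))‖ ≤ |c| * η * V := by
        refine norm_setIntegral_le_of_norm_le_const (isCompact_closedBall x 2).measure_lt_top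
          fun y _ => ?_
        rw [← mul_sub, Real.norm_eq_abs, abs_mul]
        refine mul_le_mul ((hc n y).trans (le_abs_self c)) ?_ (abs_nonneg _) (abs_nonneg _)
        rw [← Real.dist_eq]
        refine (hδ' ?_).le
        rw [dist_sub_right, dist_comm]
        exact hx2
      refine hb.trans_lt ?_
      have : |c| * η * V = ε / 3 * (|c| * V / (|c| * V + 1)) := by simp only [η]; ring
      rw [this]
      refine mul_lt_of_lt_one_right (by positivity) ?_
      rw [div_lt_one (by positivity)]
      linarith
    · intro y hy
      have hy : 2 < ‖x - y‖ := by simpa [dist_eq_norm, norm_sub_rev] using hy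
      have hy' : 1 < ‖x' - y‖ := by
        have : x - y = (x' - y) - (x' - x) := by abel
        have h1 : ‖x - y‖ ≤ ‖x' - y‖ + ‖x' - x‖ := by rw [this]; exact norm_sub_le _ _
        linarith
      rw [logKernel_eq_zero hlog ((inv_two_pow_le_one k).trans_lt (by linarith)),
        logKernel_eq_zero hlog ((inv_two_pow_le_one k).trans_lt hy')]
      simp
  have h1 := happ n k x M (hM' n x (by simp))
  have h2 := happ n k x' M (hM' n x' hx1)
  rw [Real.dist_eq]
  have h3 : Y n x - Y n x' = -(mollify (logKernel w k) (Y n) x - Y n x) +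
      (mollify (logKernel w k) (Y n) x - mollify (logKernel w k) (Y n) x') +
      (mollify (logKernel w k) (Y n) x' - Y n x') := by ring
  rw [h3]
  refine (abs_add_three _ _ _).trans_lt ?_
  rw [abs_neg]
  linarith

end LogKernel

/-! ### Extraction of a convergent subsequence -/

/-- A bounded equicontinuous sequence of functions on a separable space has a pointwise convergent
subsequence with continuous limit. -/
theorem Equicontinuous.exists_tendsto_subseq {X : Type*} [TopologicalSpace X]
    [TopologicalSpace.SeparableSpace X] [Nonempty X] {Y : ℕ → X → ℝ} {c : ℝ}
    (hY : Equicontinuous Y) (hc : ∀ n x, |Y n x| ≤ c) :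
    ∃ (y : X → ℝ) (θ : ℕ → ℕ), StrictMono θ ∧ Continuous y ∧
      ∀ x, Tendsto (fun n => Y (θ n) x) atTop (nhds (y x)) := by
  -- Compactness of a countable product of intervals replaces the diagonal argument on a dense
  -- sequence.
  have hK : IsCompact (Set.pi Set.univ fun _ : ℕ => Set.Icc (-c) c) :=
    isCompact_univ_pi fun _ => isCompact_Icc
  obtain ⟨a, -, θ, hθ, ha⟩ := hK.tendsto_subseq
    (x := fun n j => Y n (TopologicalSpace.denseSeq X j))
    fun n j _ => abs_le.1 (hc n _)
  have hcauchy : ∀ x, CauchySeq fun n => Y (θ n) x := by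
    intro x
    rw [Metric.cauchySeq_iff']
    intro ε hε
    have hnear := Metric.equicontinuousAt_iff_right.1 (hY x) (ε / 3) (by positivity)
    obtain ⟨z, hz, j, rfl⟩ := (mem_closure_iff_nhds.1
      ((TopologicalSpace.denseRange_denseSeq X) x)) _ hnear
    obtain ⟨N, hN⟩ := Metric.cauchySeq_iff'.1 ((tendsto_pi_nhds.1 ha j).cauchySeq) (ε / 3)
      (by positivity)
    refine ⟨N, fun n hn => ?_⟩
    have h1 := hz (θ n)
    have h2 := hz (θ N)
    have h3 := hN n hn
    simp only [Function.comp, Real.dist_eq, abs_lt] at h1 h2 h3 ⊢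
    constructor <;> linarith
  choose y hy using fun x => cauchySeq_tendsto_of_complete (hcauchy x)
  refine ⟨y, θ, hθ, ?_, hy⟩
  exact (tendsto_pi_nhds.2 hy).continuous_of_equicontinuous (hY.comp θ)

/-! ### Heat kernel and resolvent of the Laplacian -/

/-- The heat kernel of the plane. -/
noncomputable def heatKernel (s : ℝ) (x : Plane) : ℝ :=
  (4 * Real.pi * s)⁻¹ * Real.exp (-(‖x‖ ^ 2 / (4 * s)))

theorem heatKernel_nonneg {s : ℝ} (hs : 0 ≤ s) (x : Plane) : 0 ≤ heatKernel s x := by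
  unfold heatKernel; positivity

theorem contDiff_heatKernel (s : ℝ) : ContDiff ℝ ∞ (heatKernel s) := by
  unfold heatKernel
  exact contDiff_const.mul (((contDiff_norm_sq ℝ).div_const _).neg.exp)

theorem integral_heatKernel {s : ℝ} (hs : 0 < s) : ∫ x, heatKernel s x = 1 := by
  have h := GaussianFourier.integral_rexp_neg_mul_sq_norm (V := Plane)
    (b := (4 * s)⁻¹) (by positivity)
  have h2 : ∀ x : Plane, heatKernel s x =
      (4 * Real.pi * s)⁻¹ * Real.exp (-(4 * s)⁻¹ * ‖x‖ ^ 2) := fun x => by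
    rw [heatKernel]; congr 2; ring
  simp only [h2, integral_const_mul, h]
  simp
  field_simp

theorem integrable_heatKernel {s : ℝ} (hs : 0 < s) : Integrable (heatKernel s) :=
  integrable_of_integral_eq_one (integral_heatKernel hs)

theorem lap_heatKernel {s : ℝ} (hs : 0 < s) (x : Plane) :
    lap (heatKernel s) x = heatKernel s x * (‖x‖ ^ 2 / (4 * s ^ 2) - s⁻¹) := by
  set β : ℝ → ℝ := fun r => (4 * Real.pi * s)⁻¹ * Real.exp (-(r / (4 * s)))
  have hd : ∀ r, HasDerivAt β (-(4 * s)⁻¹ * β r) r := fun r => by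
    have := ((((hasDerivAt_id r).div_const (4 * s)).neg.exp).const_mul (4 * Real.pi * s)⁻¹)
    refine this.congr_deriv ?_
    simp only [β, Pi.neg_apply, id]
    ring
  have h1 : deriv β = fun r => -(4 * s)⁻¹ * β r := funext fun r => (hd r).deriv
  have h2 : deriv (deriv β) (‖x‖ ^ 2) = -(4 * s)⁻¹ * (-(4 * s)⁻¹ * β (‖x‖ ^ 2)) := by
    rw [h1]; exact ((hd _).const_mul _).deriv
  have hβ : ContDiff ℝ 2 β := by simp only [β]; fun_prop
  change lap (fun y => β (‖y‖ ^ 2)) x = _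
  rw [lap_radial hβ.contDiffAt, h2, h1]
  change _ = β (‖x‖ ^ 2) * _
  field_simp
  ring

theorem hasDerivAt_heatKernel {s : ℝ} (hs : 0 < s) (x : Plane) :
    HasDerivAt (fun s => heatKernel s x) (lap (heatKernel s) x) s := by
  have h1 : HasDerivAt (fun s : ℝ => (4 * Real.pi * s)⁻¹) _ s :=
    ((hasDerivAt_id s).const_mul (4 * Real.pi)).inv (by simp; positivity)
  have h2 : HasDerivAt (fun s : ℝ => ‖x‖ ^ 2 / (4 * s)) _ s :=
    (hasDerivAt_const s (‖x‖ ^ 2)).div ((hasDerivAt_id s).const_mul 4) (by simp; positivity)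
  refine (h1.mul h2.neg.exp).congr_deriv ?_
  rw [lap_heatKernel hs, heatKernel]
  simp only [Pi.neg_apply, id]
  field_simp
  ring

/-- The heat semigroup applied to `φ`, at the origin. -/
noncomputable def heatAverage (φ : Plane → ℝ) (s : ℝ) : ℝ := ∫ y, heatKernel s y * φ y

/-- Differentiate under the integral, use the heat equation, and move the Laplacian onto φ by
Green's identity. -/
theorem hasDerivAt_heatAverage {φ : Plane → ℝ} (hφ : ContDiff ℝ ∞ φ) (hc : HasCompactSupport φ)
    {s : ℝ} (hs : 0 < s) : HasDerivAt (heatAverage φ) (heatAverage (lap φ) s) s := by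
  obtain ⟨R, hR⟩ := hc.isCompact.isBounded.subset_closedBall (0 : Plane)
  have hφi : Integrable φ := hφ.continuous.integrable_of_hasCompactSupport hc
  -- On this ball times exceed s/2, which keeps the kernel and its Laplacian bounded on the support
  -- of φ.
  have hball : Metric.ball s (s / 2) ∈ nhds s := Metric.ball_mem_nhds s (by positivity)
  have key := (hasDerivAt_integral_of_dominated_loc_of_deriv_le (μ := (volume : Measure Plane))
    (F := fun s y => heatKernel s y * φ y) (F' := fun s y => lap (heatKernel s) y * φ y)
    (bound := fun y => (2 * Real.pi * s)⁻¹ * (R ^ 2 / s ^ 2 + 2 / s) * |φ y|) hball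
    (.of_forall fun s => ((contDiff_heatKernel s).continuous.mul
      hφ.continuous).aestronglyMeasurable)
    (((contDiff_heatKernel s).continuous.mul hφ.continuous).integrable_of_hasCompactSupport
      hc.mul_left)
    ((contDiff_heatKernel s).lap.continuous.mul hφ.continuous).aestronglyMeasurable
    (.of_forall fun y r hr => ?_) (hφi.abs.const_mul _) (.of_forall fun y r hr => ?_)).2
  · rw [← integral_mul_lap (contDiff_heatKernel s) hφ hc] at key
    exact key
  · rw [Real.norm_eq_abs, abs_mul]
    by_cases hy : φ y = 0
    · simp [hy]
    refine mul_le_mul_of_nonneg_right ?_ (abs_nonneg _)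
    rw [Metric.mem_ball, Real.dist_eq, abs_lt] at hr
    have hr0 : s / 2 < r := by linarith
    have hrpos : 0 < r := by linarith
    have hyR : ‖y‖ ≤ R := by simpa using hR (subset_tsupport _ hy)
    rw [lap_heatKernel hrpos, abs_mul, abs_of_nonneg (heatKernel_nonneg hrpos.le _)]
    refine mul_le_mul ?_ ?_ (abs_nonneg _) (by positivity)
    · rw [heatKernel]
      calc (4 * Real.pi * r)⁻¹ * Real.exp (-(‖y‖ ^ 2 / (4 * r))) ≤ (2 * Real.pi * s)⁻¹ * 1 := by
            refine mul_le_mul ?_ (Real.exp_le_one_iff.2 (by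
              rw [neg_nonpos]; positivity)) (Real.exp_pos _).le (by positivity)
            refine inv_anti₀ (by positivity) ?_
            nlinarith [Real.pi_pos]
        _ = _ := mul_one _
    · refine (abs_sub _ _).trans ?_
      rw [abs_of_nonneg (by positivity), abs_of_pos (by positivity : 0 < r⁻¹)]
      refine add_le_add ?_ ?_
      · exact div_le_div₀ (by positivity) (by gcongr) (by positivity) (by nlinarith)
      · rw [← one_div, div_le_div_iff₀ hrpos hs]; linarith
  · rw [Metric.mem_ball, Real.dist_eq, abs_lt] at hr
    exact (hasDerivAt_heatKernel (by linarith) y).mul_const _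

theorem abs_heatAverage_le {φ : Plane → ℝ} {C : ℝ} (hC : ∀ x, |φ x| ≤ C) {s : ℝ} (hs : 0 < s) :
    |heatAverage φ s| ≤ C := by
  have h : ∫ y, heatKernel s y * C = C := by
    rw [integral_mul_const, integral_heatKernel hs, one_mul]
  rw [← h]
  refine norm_integral_le_of_norm_le (f := fun y => heatKernel s y * φ y)
    ((integrable_heatKernel hs).mul_const C) (.of_forall fun y => ?_)
  rw [Real.norm_eq_abs, abs_mul, abs_of_nonneg (heatKernel_nonneg hs.le y)]
  exact mul_le_mul_of_nonneg_left (hC y) (heatKernel_nonneg hs.le y)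

/-- Parabolic scaling fixes the kernel and moves s into φ, so that s → 0 becomes a dominated
convergence. -/
theorem heatAverage_eq_integral_comp_smul (φ : Plane → ℝ) {s : ℝ} (hs : 0 < s) :
    heatAverage φ s = ∫ z, heatKernel 1 z * φ (Real.sqrt s • z) := by
  have hq : 0 < Real.sqrt s := Real.sqrt_pos.2 hs
  have hss := Real.sq_sqrt hs.le
  have h := Measure.integral_comp_smul (volume : Measure Plane) (fun y => heatKernel s y * φ y)
    (Real.sqrt s)
  have h2 : ∀ z : Plane, heatKernel s (Real.sqrt s • z) = s⁻¹ * heatKernel 1 z := fun z => by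
    simp only [heatKernel, norm_smul, Real.norm_of_nonneg hq.le, mul_pow, hss]
    have h4 : s * ‖z‖ ^ 2 / (4 * s) = ‖z‖ ^ 2 / (4 * 1) := by field_simp
    rw [h4]
    field_simp
  simp only [h2, mul_assoc, integral_const_mul] at h
  simp [hss, abs_of_pos hs] at h
  exact (h.resolve_right hs.ne').symm

theorem tendsto_heatAverage_zero {φ : Plane → ℝ} (hφ : Continuous φ) {C : ℝ}
    (hC : ∀ x, |φ x| ≤ C) : Tendsto (heatAverage φ) (nhdsWithin 0 (Set.Ioi 0)) (nhds (φ 0)) := by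
  have h0 : φ 0 = ∫ z, heatKernel 1 z * φ 0 := by
    rw [integral_mul_const, integral_heatKernel one_pos, one_mul]
  rw [h0]
  have : Tendsto (fun s => ∫ z, heatKernel 1 z * φ (Real.sqrt s • z)) (nhdsWithin 0 (Set.Ioi 0))
      (nhds (∫ z, heatKernel 1 z * φ 0)) := by
    refine tendsto_integral_filter_of_dominated_convergence (fun z => heatKernel 1 z * C)
      (.of_forall fun s => ?_) (.of_forall fun s => .of_forall fun z => ?_)
      ((integrable_heatKernel one_pos).mul_const C) (.of_forall fun z => ?_)
    · exact ((contDiff_heatKernel 1).continuous.mul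
        (hφ.comp (continuous_const_smul _))).aestronglyMeasurable
    · rw [Real.norm_eq_abs, abs_mul, abs_of_nonneg (heatKernel_nonneg zero_le_one z)]
      exact mul_le_mul_of_nonneg_left (hC _) (heatKernel_nonneg zero_le_one z)
    · refine Tendsto.const_mul _ ?_
      have hcont : Continuous fun s : ℝ => φ (Real.sqrt s • z) := by fun_prop
      have := (hcont.tendsto 0).mono_left (nhdsWithin_le_nhds (s := Set.Ioi 0))
      simpa using this
  refine this.congr' ?_
  filter_upwards [self_mem_nhdsWithin] with s hs
  exact (heatAverage_eq_integral_comp_smul φ hs).symm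

theorem integrable_exp_mul_heatKernel {μ : ℝ} (hμ : 0 < μ) :
    Integrable (fun p : ℝ × Plane => Real.exp (-μ * p.1) * heatKernel p.1 p.2)
      ((volume.restrict (Set.Ioi 0)).prod volume) := by
  have hm : Measurable fun p : ℝ × Plane => Real.exp (-μ * p.1) * heatKernel p.1 p.2 := by
    unfold heatKernel; fun_prop
  rw [integrable_prod_iff hm.aestronglyMeasurable]
  constructor
  · filter_upwards [ae_restrict_mem measurableSet_Ioi] with s hs
    exact (integrable_heatKernel hs).const_mul _
  · refine IntegrableOn.congr_fun (f := fun s => Real.exp (-μ * s)) ?_ (fun s hs => ?_)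
      measurableSet_Ioi
    · exact exp_neg_integrableOn_Ioi 0 hμ
    · have hs : 0 < s := hs
      simp only [norm_mul, Real.norm_eq_abs, abs_of_pos (Real.exp_pos _),
        abs_of_nonneg (heatKernel_nonneg hs.le _), integral_const_mul, integral_heatKernel hs,
        mul_one]

/-- The integral kernel of `(μ - Δ)⁻¹` on the plane. -/
noncomputable def resolventKernel (μ : ℝ) (y : Plane) : ℝ :=
  ∫ s in Set.Ioi (0 : ℝ), Real.exp (-μ * s) * heatKernel s y

theorem resolventKernel_nonneg (μ : ℝ) (y : Plane) : 0 ≤ resolventKernel μ y :=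
  setIntegral_nonneg measurableSet_Ioi fun _ hs =>
    mul_nonneg (Real.exp_pos _).le (heatKernel_nonneg (le_of_lt hs) y)

theorem integrable_resolventKernel {μ : ℝ} (hμ : 0 < μ) : Integrable (resolventKernel μ) :=
  (integrable_exp_mul_heatKernel hμ).integral_prod_right

theorem resolventKernel_neg (μ : ℝ) (y : Plane) : resolventKernel μ (-y) = resolventKernel μ y := by
  simp [resolventKernel, heatKernel]

theorem integral_resolventKernel_mul {μ : ℝ} (hμ : 0 < μ) {ψ : Plane → ℝ} (hψ : Continuous ψ)
    {C : ℝ} (hC : ∀ x, |ψ x| ≤ C) :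
    IntegrableOn (fun s => Real.exp (-μ * s) * heatAverage ψ s) (Set.Ioi 0) ∧
      ∫ y, resolventKernel μ y * ψ y =
        ∫ s in Set.Ioi (0 : ℝ), Real.exp (-μ * s) * heatAverage ψ s := by
  have hi : Integrable (fun p : ℝ × Plane => Real.exp (-μ * p.1) * heatKernel p.1 p.2 * ψ p.2)
      ((volume.restrict (Set.Ioi 0)).prod volume) :=
    (integrable_exp_mul_heatKernel hμ).mul_bdd
      (c := C) (hψ.comp continuous_snd).aestronglyMeasurable (.of_forall fun p => hC p.2)
  have h1 : ∀ s, ∫ y, Real.exp (-μ * s) * heatKernel s y * ψ y =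
      Real.exp (-μ * s) * heatAverage ψ s := fun s => by
    simp only [mul_assoc, integral_const_mul, heatAverage]
  constructor
  · have := hi.integral_prod_left
    simp only [h1] at this
    exact this
  · simp only [← h1]
    rw [integral_integral_swap hi]
    refine integral_congr_ae (.of_forall fun y => ?_)
    simp only [resolventKernel, integral_mul_const]

theorem integral_resolventKernel {μ : ℝ} (hμ : 0 < μ) : ∫ y, resolventKernel μ y = μ⁻¹ := by
  have h := (integral_resolventKernel_mul hμ (ψ := fun _ => 1) continuous_const (C := 1)
    (by simp)).2
  simp only [mul_one] at h
  rw [h, setIntegral_congr_fun (g := fun s => Real.exp (-μ * s)) measurableSet_Ioi]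
  · rw [integral_exp_mul_Ioi (by linarith : -μ < 0)]
    simp [neg_div_neg_eq]
  · intro s hs
    simp [heatAverage, integral_heatKernel (show 0 < s from hs)]

/-- The resolvent kernel is a fundamental solution of `μ - Δ`. -/
theorem integral_resolventKernel_mul_sub_lap {μ : ℝ} (hμ : 0 < μ) {φ : Plane → ℝ}
    (hφ : ContDiff ℝ ∞ φ) (hc : HasCompactSupport φ) :
    ∫ y, resolventKernel μ y * (μ * φ y - lap φ y) = φ 0 := by
  obtain ⟨C, hC⟩ := hc.exists_bound_of_continuous hφ.continuous
  have hψ : Continuous fun y => μ * φ y - lap φ y :=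
    (continuous_const.mul hφ.continuous).sub hφ.lap.continuous
  have hψc : HasCompactSupport fun y => μ * φ y - lap φ y := hc.mul_left.sub hc.lap
  obtain ⟨C', hC'⟩ := hψc.exists_bound_of_continuous hψ
  obtain ⟨hint, heq⟩ := integral_resolventKernel_mul hμ hψ hC'
  have havg : ∀ s, heatAverage (fun y => μ * φ y - lap φ y) s =
      μ * heatAverage φ s - heatAverage (lap φ) s := fun s => by
    unfold heatAverage
    rw [← integral_const_mul, ← integral_sub]
    · exact integral_congr_ae (.of_forall fun y => by simp only; ring)
    · exact (((contDiff_heatKernel s).continuous.mul hφ.continuous).integrable_of_hasCompactSupport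
        hc.mul_left).const_mul μ
    · exact ((contDiff_heatKernel s).continuous.mul
        hφ.lap.continuous).integrable_of_hasCompactSupport hc.lap.mul_left
  have hexp : ∀ s : ℝ, HasDerivAt (fun s => Real.exp (-μ * s)) (Real.exp (-μ * s) * -μ) s :=
    fun s => by simpa using ((hasDerivAt_id s).const_mul (-μ)).exp
  -- The integrand is the derivative of −e^{−μs} `heatAverage φ s`. The value at s = 0 must be set
  -- to φ 0 by hand, since the formula for `heatKernel` degenerates there.
  rw [heq, integral_Ioi_of_hasDerivAt_of_tendsto (m := 0)
    (f := fun s => -(Real.exp (-μ * s) * Function.update (heatAverage φ) 0 (φ 0) s)) ?_ ?_ hint ?_]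
  · simp
  · have h1 : ContinuousWithinAt (Function.update (heatAverage φ) 0 (φ 0)) (Set.Ici 0) 0 := by
      rw [continuousWithinAt_update_same, Set.Ici_sdiff_left]
      exact tendsto_heatAverage_zero hφ.continuous hC
    exact ((by fun_prop : Continuous fun s : ℝ => Real.exp (-μ * s)).continuousWithinAt.mul h1).neg
  · intro s hs
    have hs : 0 < s := hs
    have h1 : HasDerivAt (Function.update (heatAverage φ) 0 (φ 0)) (heatAverage (lap φ) s) s := by
      refine (hasDerivAt_heatAverage hφ hc hs).congr_of_eventuallyEq ?_
      filter_upwards [Ioi_mem_nhds hs] with r hr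
      exact Function.update_of_ne (ne_of_gt hr) _ _
    refine ((hexp s).mul h1).neg.congr_deriv ?_
    rw [havg, Function.update_of_ne hs.ne']
    ring
  · have hz : Tendsto (fun s : ℝ => Real.exp (-μ * s) * C) atTop (nhds 0) := by
      have : Tendsto (fun s : ℝ => -μ * s) atTop atBot :=
        tendsto_id.const_mul_atTop_of_neg (by linarith)
      simpa using (Real.tendsto_exp_atBot.comp this).mul_const C
    refine squeeze_zero_norm' ?_ hz
    filter_upwards [eventually_gt_atTop 0] with s hs
    rw [norm_neg, norm_mul, Real.norm_of_nonneg (Real.exp_pos _).le,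
      Function.update_of_ne (ne_of_gt hs)]
    exact mul_le_mul_of_nonneg_left (abs_heatAverage_le hC hs) (Real.exp_pos _).le

/-- Approximating G in L¹ by continuous compactly supported kernels changes the convolution with
bounded f uniformly little. -/
theorem continuous_mollify_of_integrable {G f : Plane → ℝ} {C : ℝ} (hG : Integrable G)
    (hf : AEStronglyMeasurable f volume) (hC : ∀ x, |f x| ≤ C) : Continuous (mollify G f) := by
  have hC0 : 0 ≤ C := (abs_nonneg _).trans (hC 0)
  have hli : LocallyIntegrable f volume :=
    IsLocallyBounded.locallyIntegrable (fun _ => ⟨C, fun x _ => hC x⟩) hf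
  refine continuous_of_uniform_approx_of_continuous fun U hU => ?_
  obtain ⟨ε, hε, hεU⟩ := Metric.mem_uniformity_dist.1 hU
  obtain ⟨g, hgc, hgi, hg, hgint⟩ := hG.exists_hasCompactSupport_integral_sub_le
    (show 0 < ε / (2 * (C + 1)) by positivity)
  refine ⟨mollify g f, hgc.continuous_convolution_right (ContinuousLinearMap.mul ℝ ℝ) hli hg,
    fun x => hεU ?_⟩
  have hI : ∀ k : Plane → ℝ, Integrable k → Integrable fun y => f y * k (x - y) := fun k hk =>
    (hk.comp_sub_left x).bdd_mul hf (.of_forall hC)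
  rw [Real.dist_eq, mollify, mollify, ← integral_sub (hI G hG) (hI g hgint)]
  have h1 : ‖∫ y, (f y * G (x - y) - f y * g (x - y))‖ ≤ ∫ y, C * ‖G (x - y) - g (x - y)‖ := by
    refine norm_integral_le_of_norm_le ?_ (.of_forall fun y => ?_)
    · exact (((hG.sub hgint).comp_sub_left x).norm).const_mul C
    · rw [← mul_sub, norm_mul]
      exact mul_le_mul_of_nonneg_right (hC y) (norm_nonneg _)
  rw [integral_const_mul, integral_sub_left_eq_self (fun z => ‖G z - g z‖) volume x] at h1
  rw [← Real.norm_eq_abs]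
  refine h1.trans_lt ?_
  calc C * ∫ z, ‖G z - g z‖ ≤ C * (ε / (2 * (C + 1))) := mul_le_mul_of_nonneg_left hgi hC0
    _ = ε * (C / (2 * (C + 1))) := by ring
    _ < ε := by
      refine mul_lt_of_lt_one_right hε ?_
      rw [div_lt_one (by positivity)]
      linarith

theorem abs_mollify_resolventKernel_le {μ C : ℝ} (hμ : 0 < μ) {f : Plane → ℝ}
    (hC : ∀ x, |f x| ≤ C) (x : Plane) : |mollify (resolventKernel μ) f x| ≤ C / μ := by
  have hi : Integrable fun y => C * resolventKernel μ (x - y) :=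
    ((integrable_resolventKernel hμ).comp_sub_left x).const_mul C
  have h : ∫ y, C * resolventKernel μ (x - y) = C / μ := by
    rw [integral_const_mul, integral_sub_left_eq_self (resolventKernel μ) volume x,
      integral_resolventKernel hμ, div_eq_mul_inv]
  rw [← h]
  refine norm_integral_le_of_norm_le (f := fun y => f y * resolventKernel μ (x - y)) hi
    (.of_forall fun y => ?_)
  rw [Real.norm_eq_abs, abs_mul, abs_of_nonneg (resolventKernel_nonneg _ _)]
  exact mul_le_mul_of_nonneg_right (hC y) (resolventKernel_nonneg _ _)

/-- `mollify (resolventKernel μ) f` solves `Δ u = μ u - f`. -/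
theorem weakLap_mollify_resolventKernel {μ C : ℝ} (hμ : 0 < μ) {f : Plane → ℝ}
    (hf : AEStronglyMeasurable f volume) (hC : ∀ x, |f x| ≤ C) :
    WeakLap (mollify (resolventKernel μ) f)
      (fun x => μ * mollify (resolventKernel μ) f x - f x) := by
  set S := mollify (resolventKernel μ) f
  have hG := integrable_resolventKernel hμ
  have hS : Continuous S := continuous_mollify_of_integrable hG hf hC
  have hli : LocallyIntegrable f volume :=
    IsLocallyBounded.locallyIntegrable (fun _ => ⟨C, fun x _ => hC x⟩) hf
  refine ⟨hS.locallyIntegrable, ((continuous_const.mul hS).locallyIntegrable).sub hli,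
    fun φ hφ hc => ?_⟩
  have hψ : Continuous fun y => μ * φ y - lap φ y :=
    (continuous_const.mul hφ.continuous).sub hφ.lap.continuous
  have hψc : HasCompactSupport fun y => μ * φ y - lap φ y := hc.mul_left.sub hc.lap
  have hψi : Integrable fun y => μ * φ y - lap φ y := hψ.integrable_of_hasCompactSupport hψc
  have hprod : Integrable (fun p : Plane × Plane =>
      f p.1 * resolventKernel μ (p.2 - p.1) * (μ * φ p.2 - lap φ p.2)) (volume.prod volume) := by
    have h1 := hψi.convolution_integrand (ContinuousLinearMap.mul ℝ ℝ) hG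
      (μ := volume) (ν := volume)
    have h2 := h1.bdd_mul (f := fun p : Plane × Plane => f p.1) (c := C) hf.comp_fst
      (.of_forall fun p => hC p.1)
    refine h2.congr (.of_forall fun p => ?_)
    simp only [ContinuousLinearMap.mul_apply']
    rw [← neg_sub p.2 p.1, resolventKernel_neg]
    ring
  have hinner : ∀ y, ∫ x, f y * resolventKernel μ (x - y) * (μ * φ x - lap φ x) = f y * φ y := by
    intro y
    have hl : ∀ z, lap (fun z => φ (y + z)) z = lap φ (y + z) := fun z => by
      simpa using lap_comp_affine hφ y 1 z
    have h1 := integral_resolventKernel_mul_sub_lap hμ (φ := fun z => φ (y + z))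
      (hφ.comp (contDiff_const.add contDiff_id)) (hc.comp_homeomorph (Homeomorph.addLeft y))
    simp only [hl, add_zero] at h1
    rw [← h1]
    simp only [mul_assoc, integral_const_mul]
    congr 1
    rw [← integral_add_left_eq_self _ y]
    simp
  have hmain : ∫ x, S x * (μ * φ x - lap φ x) = ∫ x, f x * φ x := by
    have h1 : ∀ x, S x * (μ * φ x - lap φ x) =
        ∫ y, f y * resolventKernel μ (x - y) * (μ * φ x - lap φ x) := fun x => by
      rw [integral_mul_const]; rfl
    simp only [h1]
    -- Fubini reduces the weak equation to the fundamental solution property, translated to each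
    -- point y.
    rw [← integral_integral_swap hprod]
    simp only [hinner]
  have i1 : Integrable fun x => S x * lap φ x :=
    (hS.mul hφ.lap.continuous).integrable_of_hasCompactSupport hc.lap.mul_left
  have i2 : Integrable fun x => μ * S x * φ x :=
    ((continuous_const.mul hS).mul hφ.continuous).integrable_of_hasCompactSupport hc.mul_left
  have i3 : Integrable fun x => f x * φ x :=
    LocallyIntegrable.integrable_mul_test hli hφ.continuous hc
  have h1 : ∫ x, S x * (μ * φ x - lap φ x) = (∫ x, μ * S x * φ x) - ∫ x, S x * lap φ x := by
    rw [← integral_sub i2 i1]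
    exact integral_congr_ae (.of_forall fun x => by simp only; ring)
  simp only [sub_mul]
  rw [integral_sub i2 i3]
  linarith

/-! ### Solving the exponential equation -/

theorem exp_sub_exp_le {a b : ℝ} : Real.exp b - Real.exp a ≤ (b - a) * Real.exp b := by
  have h := Real.add_one_le_exp (a - b)
  have h2 : Real.exp a = Real.exp b * Real.exp (a - b) := by rw [← Real.exp_add]; congr 1; ring
  rw [h2]
  nlinarith [Real.exp_pos b]

/-- The exponential nonlinearity, shifted by `l` so as to be monotone on bounded intervals. -/
noncomputable def shiftedNonlinearity (l t q v s : ℝ) : ℝ :=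
  l * s - q * (Real.exp (2 * (s + v)) - Real.exp (2 * t))

/-- The shift dominates the s-derivative 2 q e^{2(s+v)} for s ≤ c, so the shifted nonlinearity is
nondecreasing with slope at most the shift. -/
theorem shiftedNonlinearity_sub_mem_Icc {Q V c t q v s s' : ℝ} (hq : 0 ≤ q) (hqQ : q ≤ Q)
    (hv : |v| ≤ V) (hss : s ≤ s') (hs' : s' ≤ c) :
    shiftedNonlinearity (Q * (2 * Real.exp (2 * (c + V)))) t q v s' -
      shiftedNonlinearity (Q * (2 * Real.exp (2 * (c + V)))) t q v s ∈
      Set.Icc 0 (Q * (2 * Real.exp (2 * (c + V))) * (s' - s)) := by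
  have h1 : Real.exp (2 * (s' + v)) - Real.exp (2 * (s + v)) ≤
      2 * Real.exp (2 * (c + V)) * (s' - s) := by
    refine exp_sub_exp_le.trans ?_
    have h2 : Real.exp (2 * (s' + v)) ≤ Real.exp (2 * (c + V)) :=
      Real.exp_le_exp.2 (by linarith [(abs_le.1 hv).2])
    nlinarith
  have h0 : 0 ≤ Real.exp (2 * (s' + v)) - Real.exp (2 * (s + v)) :=
    sub_nonneg.2 (Real.exp_le_exp.2 (by linarith))
  have h3 : q * (Real.exp (2 * (s' + v)) - Real.exp (2 * (s + v))) ≤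
      Q * (2 * Real.exp (2 * (c + V)) * (s' - s)) := mul_le_mul hqQ h1 h0 (hq.trans hqQ)
  have h4 := mul_nonneg hq h0
  unfold shiftedNonlinearity
  constructor <;> nlinarith

/-- By monotonicity only s = ±c matters. There V + |t| ≤ c fixes the sign of the exponential
difference: the constants ±c act as barriers. -/
theorem abs_shiftedNonlinearity_le {Q V c t q v s : ℝ} (hq : 0 ≤ q) (hqQ : q ≤ Q)
    (hv : |v| ≤ V) (hc : V + |t| ≤ c) (hs : |s| ≤ c) :
    |shiftedNonlinearity (Q * (2 * Real.exp (2 * (c + V)))) t q v s| ≤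
      Q * (2 * Real.exp (2 * (c + V))) * c := by
  obtain ⟨hs1, hs2⟩ := abs_le.1 hs
  obtain ⟨hv1, hv2⟩ := abs_le.1 hv
  obtain ⟨ht1, ht2⟩ := abs_le.1 (le_refl |t|)
  have h1 := (shiftedNonlinearity_sub_mem_Icc (t := t) hq hqQ hv hs2 le_rfl).1
  have h2 := (shiftedNonlinearity_sub_mem_Icc (t := t) hq hqQ hv hs1 hs2).1
  have e1 : 0 ≤ q * (Real.exp (2 * (c + v)) - Real.exp (2 * t)) :=
    mul_nonneg hq (sub_nonneg.2 (Real.exp_le_exp.2 (by linarith)))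
  have e2 : q * (Real.exp (2 * (-c + v)) - Real.exp (2 * t)) ≤ 0 :=
    mul_nonpos_of_nonneg_of_nonpos hq (sub_nonpos.2 (Real.exp_le_exp.2 (by linarith)))
  rw [abs_le]
  set l := Q * (2 * Real.exp (2 * (c + V)))
  have h3 : shiftedNonlinearity l t q v c =
      l * c - q * (Real.exp (2 * (c + v)) - Real.exp (2 * t)) := rfl
  have h4 : shiftedNonlinearity l t q v (-c) =
      l * -c - q * (Real.exp (2 * (-c + v)) - Real.exp (2 * t)) := rfl
  constructor <;> linarith

/-- Truncation to the interval `[-c, c]`. -/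
noncomputable def clamp (c s : ℝ) : ℝ := max (-c) (min s c)

theorem continuous_clamp (c : ℝ) : Continuous (clamp c) := by unfold clamp; fun_prop

theorem abs_clamp_le {c : ℝ} (hc : 0 ≤ c) (s : ℝ) : |clamp c s| ≤ c := by
  rw [abs_le, clamp]
  exact ⟨le_max_left _ _, max_le (by linarith) (min_le_right _ _)⟩

theorem clamp_eq_self {c s : ℝ} (hs : |s| ≤ c) : clamp c s = s := by
  rw [clamp, min_eq_left (abs_le.1 hs).2, max_eq_right (abs_le.1 hs).1]

theorem abs_clamp_sub_clamp_le (c s s' : ℝ) : |clamp c s - clamp c s'| ≤ |s - s'| := by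
  have h1 := abs_max_sub_max_le_max (-c) (min s c) (-c) (min s' c)
  have h2 := abs_min_sub_min_le_max s c s' c
  exact h1.trans (max_le (by simp) (h2.trans (max_le le_rfl (by simp))))

theorem abs_shiftedNonlinearity_sub_le {Q V c t q v s s' : ℝ} (hq : 0 ≤ q) (hqQ : q ≤ Q)
    (hv : |v| ≤ V) (hs : |s| ≤ c) (hs' : |s'| ≤ c) :
    |shiftedNonlinearity (Q * (2 * Real.exp (2 * (c + V)))) t q v s -
      shiftedNonlinearity (Q * (2 * Real.exp (2 * (c + V)))) t q v s'| ≤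
      Q * (2 * Real.exp (2 * (c + V))) * |s - s'| := by
  rcases le_total s s' with h | h
  · have h1 := shiftedNonlinearity_sub_mem_Icc (t := t) hq hqQ hv h (abs_le.1 hs').2
    rw [abs_sub_comm, abs_of_nonneg h1.1, abs_sub_comm s, abs_of_nonneg (sub_nonneg.2 h)]
    exact h1.2
  · have h1 := shiftedNonlinearity_sub_mem_Icc (t := t) hq hqQ hv h (abs_le.1 hs).2
    rw [abs_of_nonneg h1.1, abs_of_nonneg (sub_nonneg.2 h)]
    exact h1.2

/-- Solvability of the regularized equation `Δ y = ε y + q (e^{2(y+v)} - e^{2t})` with bounded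
coefficients. -/
theorem exists_weakLap_regularized {q v : Plane → ℝ} {Q V t c ε : ℝ}
    (hqm : AEStronglyMeasurable q volume) (hq : ∀ x, 0 ≤ q x) (hqQ : ∀ x, q x ≤ Q)
    (hvc : Continuous v) (hv : ∀ x, |v x| ≤ V) (hc : V + |t| ≤ c) (hε : 0 < ε) :
    ∃ y : Plane → ℝ, Continuous y ∧ (∀ x, |y x| ≤ c) ∧
      WeakLap y (fun x => ε * y x + q x * (Real.exp (2 * (y x + v x)) - Real.exp (2 * t))) := by
  have hV : 0 ≤ V := (abs_nonneg _).trans (hv 0)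
  have hc0 : 0 ≤ c := (add_nonneg hV (abs_nonneg t)).trans hc
  have hQ : 0 ≤ Q := (hq 0).trans (hqQ 0)
  set l := Q * (2 * Real.exp (2 * (c + V))) with hl
  have hl0 : 0 ≤ l := by positivity
  have hμ : 0 < l + ε := by positivity
  -- Clamping makes the nonlinearity bounded and Lipschitz on all functions; it is shown inactive at
  -- the fixed point.
  set N : (Plane → ℝ) → Plane → ℝ := fun f x =>
    shiftedNonlinearity l t (q x) (v x) (clamp c (f x))
  have hNm : ∀ f : Plane → ℝ, Continuous f → AEStronglyMeasurable (N f) volume := fun f hf => by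
    have h1 : Continuous fun x => clamp c (f x) := (continuous_clamp c).comp hf
    have h2 : Continuous fun x => Real.exp (2 * (clamp c (f x) + v x)) - Real.exp (2 * t) := by
      fun_prop
    exact (continuous_const.mul h1).aestronglyMeasurable.sub (hqm.mul h2.aestronglyMeasurable)
  have hNb : ∀ (f : Plane → ℝ) x, |N f x| ≤ l * c := fun f x =>
    abs_shiftedNonlinearity_le (hq x) (hqQ x) (hv x) hc (abs_clamp_le hc0 _)
  have hG := integrable_resolventKernel hμ
  set T : BoundedContinuousFunction Plane ℝ → BoundedContinuousFunction Plane ℝ := fun f =>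
    BoundedContinuousFunction.ofNormedAddCommGroup (mollify (resolventKernel (l + ε)) (N f))
      (continuous_mollify_of_integrable hG (hNm f f.continuous) (hNb f)) (l * c / (l + ε))
      (abs_mollify_resolventKernel_le hμ (hNb f))
  -- N has Lipschitz constant l and the resolvent has norm at most 1/(l + ε). This strict
  -- contraction is the reason for the term ε y.
  have hT : ContractingWith (Real.toNNReal (l / (l + ε))) T := by
    refine ⟨?_, LipschitzWith.of_dist_le_mul fun f g => ?_⟩
    · rw [Real.toNNReal_lt_one, div_lt_one hμ]; linarith
    rw [Real.coe_toNNReal _ (by positivity),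
      BoundedContinuousFunction.dist_le (by positivity)]
    intro x
    have hI : ∀ f : BoundedContinuousFunction Plane ℝ,
        Integrable fun y => N f y * resolventKernel (l + ε) (x - y) := fun f =>
      (hG.comp_sub_left x).bdd_mul (hNm f f.continuous) (.of_forall (hNb f))
    have h1 : T f x - T g x =
        mollify (resolventKernel (l + ε)) (fun y => N f y - N g y) x := by
      change mollify _ (N f) x - mollify _ (N g) x = _
      unfold mollify
      rw [← integral_sub (hI f) (hI g)]
      simp only [sub_mul]
    rw [Real.dist_eq, h1, div_mul_eq_mul_div]
    refine abs_mollify_resolventKernel_le hμ (fun y => ?_) x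
    refine (abs_shiftedNonlinearity_sub_le (hq y) (hqQ y) (hv y) (abs_clamp_le hc0 _)
      (abs_clamp_le hc0 _)).trans (mul_le_mul_of_nonneg_left ?_ hl0)
    exact (abs_clamp_sub_clamp_le _ _ _).trans
      (BoundedContinuousFunction.dist_coe_le_dist (f := f) (g := g) y)
  set y := ContractingWith.fixedPoint T hT
  have hy : ∀ x, y x = mollify (resolventKernel (l + ε)) (N y) x := fun x =>
    (DFunLike.congr_fun hT.fixedPoint_isFixedPt x).symm
  -- Since l c / (l + ε) ≤ c, the fixed point stays where the clamp is the identity.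
  have hyc : ∀ x, |y x| ≤ c := fun x => by
    rw [hy]
    refine (abs_mollify_resolventKernel_le hμ (hNb y) x).trans ?_
    rw [div_le_iff₀ hμ]
    nlinarith
  refine ⟨y, y.continuous, hyc, ?_⟩
  have h := weakLap_mollify_resolventKernel hμ (hNm y y.continuous) (hNb y)
  have h2 : mollify (resolventKernel (l + ε)) (N y) = y := funext fun x => (hy x).symm
  rw [h2] at h
  refine h.congr_ae .rfl (.of_forall fun x => ?_)
  simp only [N, shiftedNonlinearity, clamp_eq_self (hyc x)]
  ring

/-- Solvability of `Δ y = q (e^{2(y+v)} - e^{2t})` with `q` locally bounded. -/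
theorem exists_weakLap_exponential {w q v : Plane → ℝ} {V t : ℝ} (hw : ContDiff ℝ ∞ w)
    (hlog : ∀ x : Plane, 1 ≤ ‖x‖ → w x = Real.log ‖x‖)
    (hqm : AEStronglyMeasurable q volume) (hq : ∀ x, 0 ≤ q x) (hqb : IsLocallyBounded q)
    (hvc : Continuous v) (hv : ∀ x, |v x| ≤ V) :
    ∃ y : Plane → ℝ, Continuous y ∧ (∀ x, |y x| ≤ V + |t|) ∧
      WeakLap y (fun x => q x * (Real.exp (2 * (y x + v x)) - Real.exp (2 * t))) := by
  have hV : 0 ≤ V := (abs_nonneg _).trans (hv 0)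
  set c := V + |t|
  have hc0 : 0 ≤ c := add_nonneg hV (abs_nonneg t)
  set q' : ℕ → Plane → ℝ := fun n => (Metric.closedBall (0 : Plane) n).indicator q
  have hq'0 : ∀ n x, 0 ≤ q' n x := fun n x => Set.indicator_nonneg (fun x _ => hq x) x
  have hq'q : ∀ n x, q' n x ≤ q x := fun n x => Set.indicator_le_self' (fun x _ => hq x) x
  have hex : ∀ n : ℕ, ∃ y : Plane → ℝ, Continuous y ∧ (∀ x, |y x| ≤ c) ∧
      WeakLap y (fun x => 1 / ((n : ℝ) + 1) * y x +
        q' n x * (Real.exp (2 * (y x + v x)) - Real.exp (2 * t))) := by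
    intro n
    obtain ⟨Q, hQ⟩ := hqb n
    refine exists_weakLap_regularized (Q := max Q 0)
      (hqm.indicator Metric.isClosed_closedBall.measurableSet) (hq'0 n) (fun x => ?_) hvc hv le_rfl
      (by positivity)
    refine Set.indicator_le' (fun x hx => ?_) (fun x _ => le_max_right _ _) x
    exact ((le_abs_self _).trans (hQ x (by simpa using hx))).trans (le_max_left _ _)
  choose Y hYc hYb hY using hex
  set F : ℕ → Plane → ℝ := fun n x => 1 / ((n : ℝ) + 1) * Y n x +
    q' n x * (Real.exp (2 * (Y n x + v x)) - Real.exp (2 * t))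
  set B := Real.exp (2 * (c + V)) + Real.exp (2 * t)
  have hexp : ∀ {s r : ℝ}, |s| ≤ c → |r| ≤ V →
      |Real.exp (2 * (s + r)) - Real.exp (2 * t)| ≤ B := fun {s r} hs hr => by
    refine (abs_sub _ _).trans ?_
    rw [abs_of_pos (Real.exp_pos _), abs_of_pos (Real.exp_pos _)]
    refine add_le_add (Real.exp_le_exp.2 ?_) le_rfl
    linarith [(abs_le.1 hs).2, (abs_le.1 hr).2]
  -- Local bounds uniform in n, from q' n ≤ q and the common barrier c; equicontinuity needs nothing
  -- more.
  have hF : ∀ R : ℝ, ∃ M, ∀ n x, ‖x‖ ≤ R → |F n x| ≤ M := by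
    intro R
    obtain ⟨M, hM⟩ := hqb R
    refine ⟨c + M * B, fun n x hx => (abs_add_le _ _).trans (add_le_add ?_ ?_)⟩
    · rw [abs_mul, abs_of_pos (by positivity)]
      refine (mul_le_of_le_one_left (abs_nonneg _) ?_).trans (hYb n x)
      rw [div_le_one (by positivity)]
      linarith [n.cast_nonneg (α := ℝ)]
    · rw [abs_mul]
      have h1 : |q' n x| ≤ M := by
        rw [abs_of_nonneg (hq'0 n x)]
        exact (hq'q n x).trans ((le_abs_self _).trans (hM x hx))
      exact mul_le_mul h1 (hexp (hYb n x) (hv x)) (abs_nonneg _) ((abs_nonneg _).trans h1)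
  obtain ⟨y, θ, hθ, hyc, hlim⟩ :=
    (equicontinuous_of_weakLap hw hlog hY hYc hYb hF).exists_tendsto_subseq hYb
  have hyb : ∀ x, |y x| ≤ c := fun x => le_of_tendsto (hlim x).abs (.of_forall fun n => hYb _ x)
  have hec : Continuous fun x => Real.exp (2 * (y x + v x)) - Real.exp (2 * t) := by fun_prop
  refine ⟨y, hyc, hyb, hyc.locallyIntegrable,
    (hqb.mul hec.isLocallyBounded).locallyIntegrable (hqm.mul hec.aestronglyMeasurable),
    fun φ hφ hc => ?_⟩
  have lim1 : Tendsto (fun n => ∫ x, Y (θ n) x * lap φ x) atTop (nhds (∫ x, y x * lap φ x)) := by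
    refine tendsto_integral_of_dominated_convergence (fun x => c * |lap φ x|)
      (fun n => ((hYc _).mul hφ.lap.continuous).aestronglyMeasurable)
      ((hφ.lap.continuous.integrable_of_hasCompactSupport hc.lap).abs.const_mul c)
      (fun n => .of_forall fun x => ?_) (.of_forall fun x => (hlim x).mul_const _)
    rw [Real.norm_eq_abs, abs_mul]
    exact mul_le_mul_of_nonneg_right (hYb _ x) (abs_nonneg _)
  have lim2 : Tendsto (fun n => ∫ x, F (θ n) x * φ x) atTop
      (nhds (∫ x, q x * (Real.exp (2 * (y x + v x)) - Real.exp (2 * t)) * φ x)) := by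
    obtain ⟨R, hR⟩ := hc.isCompact.isBounded.subset_closedBall (0 : Plane)
    obtain ⟨M, hM⟩ := hF R
    refine tendsto_integral_of_dominated_convergence (fun x => M * |φ x|)
      (fun n => (hY (θ n)).2.1.aestronglyMeasurable.mul hφ.continuous.aestronglyMeasurable)
      ((hφ.continuous.integrable_of_hasCompactSupport hc).abs.const_mul M)
      (fun n => .of_forall fun x => ?_) (.of_forall fun x => Tendsto.mul_const _ ?_)
    · rw [Real.norm_eq_abs, abs_mul]
      by_cases hx : φ x = 0
      · simp [hx]
      · exact mul_le_mul_of_nonneg_right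
          (hM _ x (by simpa using hR (subset_tsupport _ hx))) (abs_nonneg _)
    · have h1 : Tendsto (fun n => 1 / ((θ n : ℝ) + 1)) atTop (nhds 0) :=
        (tendsto_one_div_add_atTop_nhds_zero_nat (𝕜 := ℝ)).comp hθ.tendsto_atTop
      have h2 : Tendsto (fun n => q' (θ n) x) atTop (nhds (q x)) := by
        refine tendsto_const_nhds.congr' ?_
        filter_upwards [(tendsto_natCast_atTop_atTop.comp hθ.tendsto_atTop).eventually_ge_atTop ‖x‖]
          with n hn
        exact (Set.indicator_of_mem (by simpa using hn) q).symm
      have h3 : Tendsto (fun n => Real.exp (2 * (Y (θ n) x + v x)) - Real.exp (2 * t)) atTop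
          (nhds (Real.exp (2 * (y x + v x)) - Real.exp (2 * t))) :=
        (((((hlim x).add_const _).const_mul 2).rexp).sub_const _)
      have h4 := (h1.mul (hlim x)).add (h2.mul h3)
      rw [zero_mul, zero_add] at h4
      exact h4
  exact tendsto_nhds_unique lim1 (lim2.congr fun n => ((hY (θ n)).2.2 φ hφ hc).symm)

/-! ### Assembling the solution -/

theorem exists_isLogGrowthSolution {w₀ K v : Plane → ℝ} {α t C : ℝ} (hw : ContDiff ℝ ∞ w₀)
    (hlog : ∀ x : Plane, 1 ≤ ‖x‖ → w₀ x = Real.log ‖x‖)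
    (hKm : AEStronglyMeasurable K volume) (hKb : IsLocallyBounded K) (hK : ∀ x, K x ≤ 0)
    (hvC : ∀ x, |v x| ≤ C)
    (hv : SolvesPoisson v (fun x => K x * Real.exp (2 * α * w₀ x + 2 * t) + α * lap w₀ x)) :
    ∃ u, IsLogGrowthSolution K α u := by
  have hwl := solvesPoisson_iff_weakLap.1 hv
  have hwc := hw.continuous
  have hfb : IsLocallyBounded
      (fun x => -(K x * Real.exp (2 * α * w₀ x + 2 * t) + α * lap w₀ x)) := by
    have c1 : Continuous fun x => Real.exp (2 * α * w₀ x + 2 * t) := by fun_prop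
    have c2 : Continuous fun x => α * lap w₀ x := continuous_const.mul hw.lap.continuous
    exact ((hKb.mul c1.isLocallyBounded).add c2.isLocallyBounded).neg
  obtain ⟨v', hv'c, hvv', -⟩ := hwl.exists_continuous_representative hw hlog hfb
  -- An a.e. bound on a continuous function holds everywhere: v' agrees a.e., hence identically,
  -- with its clamp.
  have hv'C : ∀ x, |v' x| ≤ C := by
    have hC : 0 ≤ C := (abs_nonneg _).trans (hvC 0)
    have h1 : (fun x => clamp C (v' x)) =ᵐ[volume] v' := by
      filter_upwards [hvv'] with x hx
      rw [← hx, clamp_eq_self (hvC x)]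
    have h2 := (Continuous.ae_eq_iff_eq volume ((continuous_clamp C).comp hv'c) hv'c).1 h1
    intro x
    rw [← congrFun h2 x]
    exact abs_clamp_le hC _
  have hec : Continuous fun x => Real.exp (2 * α * w₀ x) := by fun_prop
  obtain ⟨y, hyc, hyb, hy⟩ := exists_weakLap_exponential (t := t) hw hlog
    (q := fun x => -K x * Real.exp (2 * α * w₀ x)) (hKm.neg.mul hec.aestronglyMeasurable)
    (fun x => mul_nonneg (neg_nonneg.2 (hK x)) (Real.exp_pos _).le)
    (hKb.neg.mul hec.isLocallyBounded) hv'c hv'C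
  -- In the sum of the three Laplacians the terms α Δw₀ and q e^{2t} cancel, leaving q e^{2(y+v')} =
  -- −K e^{2u}.
  refine ⟨fun x => α * w₀ x + v' x + y x, by fun_prop, solvesPoisson_iff_weakLap.2 ?_, ?_⟩
  · refine (((hw.weakLap.const_mul α).add (hwl.congr_ae hvv' .rfl)).add hy).congr_ae .rfl
      (.of_forall fun x => ?_)
    have e1 : Real.exp (2 * α * w₀ x + 2 * t) = Real.exp (2 * α * w₀ x) * Real.exp (2 * t) :=
      Real.exp_add _ _
    have e2 : Real.exp (2 * (α * w₀ x + v' x + y x)) =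
        Real.exp (2 * α * w₀ x) * Real.exp (2 * (y x + v' x)) := by
      rw [← Real.exp_add]; congr 1; ring
    simp only [e1, e2]
    ring
  · refine isBigO_cocompact_one_iff.2 ⟨1, C + (C + |t|), fun x hx => ?_⟩
    simp only [hlog x hx.le]
    have : α * Real.log ‖x‖ + v' x + y x - α * Real.log ‖x‖ = v' x + y x := by ring
    rw [this]
    exact (abs_add_le _ _).trans (add_le_add (hv'C x) (hyb x))

theorem proposition3p2
    (w₀ : Plane → ℝ) (hw₀_smooth : ContDiff ℝ ∞ w₀)
    (hw₀_radial : ∀ x y : Plane, ‖x‖ = ‖y‖ → w₀ x = w₀ y)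
    (hw₀_log : ∀ x : Plane, 1 ≤ ‖x‖ → w₀ x = Real.log ‖x‖)
    (K : Plane → ℝ) (hK_meas : AEStronglyMeasurable K volume)
    (hK_bdd : IsLocallyBounded K) (hK_nonpos : ∀ x, K x ≤ 0)
    (α : ℝ) (hα : 0 < α) (t : ℝ)
    (hv : ∃ v : Plane → ℝ, (∃ C : ℝ, ∀ x, |v x| ≤ C) ∧
      SolvesPoisson v (fun x => K x * Real.exp (2 * α * w₀ x + 2 * t)
        + α * (Laplacian.laplacian w₀ : Plane → ℝ) x)) :
    (∃! u : Plane → ℝ, IsLogGrowthSolution K α u) ∧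
    ∀ u : Plane → ℝ, IsLogGrowthSolution K α u →
      Integrable (fun x => K x * Real.exp (2 * u x)) volume ∧
        ∫ x, K x * Real.exp (2 * u x) = -2 * α * Real.pi := by
  obtain ⟨v, ⟨C, hC⟩, hv⟩ := hv
  obtain ⟨u, hu⟩ :=
    exists_isLogGrowthSolution hw₀_smooth hw₀_log hK_meas hK_bdd hK_nonpos hC hv
  exact ⟨⟨u, hu, fun u' hu' => hu'.unique hu hK_nonpos hK_bdd hα⟩,
    fun u hu => hu.integrable_and_integral_eq hK_nonpos⟩
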